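/- Let $1\le n_J\le n_F\le N$. Consider $N$ parallel unit-speed FCFS servers. Jobs arrive according to a renewal process with non-negative interarrival times distributed as $A$, $0<E[A]<\infty$. Each job sends $n_F$ replicas to $n_F$ servers chosen uniformly at random without replacement. The replica sizes $(B_1,\dots,B_{n_F})$ of a job are non-negative with an arbitrary joint law and a common marginal law, that of $B$; the vectors of sizes of different jobs are i.i.d., and sizes, server selections and interarrival times are independent. As soon as $n_J$ replicas of a job have completed service, its remaining replicas are removed (cancel-on-completion, fork-join$(n_F,n_J)$). For a tuple $X$, let $X_{(k)}$ be its $k$-th smallest entry. If an arriving job finds the workloads (times until idle in the absence of further arrivals) $V_1,\dots,V_N$ and is sent to the servers $s_1,\dots,s_{n_F}$, then its replicas have waiting times $W_l=V_{s_l}$, and its response time is $R=(W+B)_{(n_J)}$, the $n_J$-th smallest of $W_l+B_l$, $l=1,\dots,n_F$. Steady state means that $V$ has a stationary law of the Markov chain of workloads found by successive jobs, and is independent of the selection and the sizes of the arriving job. A random variable $X$ is in $RV(-\nu)$ if $P(X>x)=L(x)x^{-\nu}$ for all $x>0$, with $L(cx)/L(x)\to1$ as $x\to\infty$ for every $c>0$.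 It is in $ORV(\eta)$ if there are constants $c_1,c_2>0$ such that for all $\alpha\ge1$ $$c_1\alpha^{\eta}<\liminf_{x\to\infty}\frac{P(X>\alpha x)}{P(X>x)}\le\limsup_{x\to\infty}\frac{P(X>\alpha x)}{P(X>x)}<c_2\alpha^{\eta}.$$ Assume that $E[B_{(n_J)}]<\infty$ and $\rho_U:=E[B_{(n_J)}]/E[A]<1$. Then a steady state exists, and in every steady state the following hold. (a) If $B_{(n_J)}\in RV(-\tilde\nu)$, then $W_{(n_J)}\in ORV(1-\tilde\nu)$ and $R\in ORV(1-\tilde\nu)$. (b) In particular, for identical replicas ($B_1=\dots=B_{n_F}$ almost surely), if $B\in RV(-\nu)$, then $W_{(n_J)}\in ORV(1-\nu)$ and $R\in ORV(1-\nu)$. (c) In particular, for i.i.d. replicas, if $B\in RV(-\nu)$, then $W_{(n_J)}\in ORV(1-(n_F+1-n_J)\nu)$ and $R\in ORV(1-(n_F+1-n_J)\nu)$. -/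

import Mathlib

open MeasureTheory Filter Set

noncomputable section

namespace ForkJoin

/-- A function is slowly varying at infinity if `L (c x) / L x → 1` as `x → ∞`, for every `c > 0`. -/
def IsSlowlyVarying (L : ℝ → ℝ) : Prop :=
  ∀ c : ℝ, 0 < c → Tendsto (fun x => L (c * x) / L x) atTop (nhds 1)

/-- The law `μ` on `ℝ` is in `RV(r)`: its tail is `μ (x, ∞) = L x * x ^ r` for all `x > 0`, with
`L` slowly varying at infinity. -/
def IsRV (μ : Measure ℝ) (r : ℝ) : Prop :=
  ∃ L : ℝ → ℝ, IsSlowlyVarying L ∧ ∀ x : ℝ, 0 < x → μ.real (Ioi x) = L x * x ^ r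

/-- The law `μ` on `ℝ` is in `ORV(r)`: there are constants `c₁, c₂ > 0` such that, for all `c ≥ 1`,
the liminf and the limsup, as `x → ∞`, of the ratio of tails `μ (c x, ∞) / μ (x, ∞)` lie strictly
between `c₁ * c ^ r` and `c₂ * c ^ r`. The ratio, the liminf and the limsup are taken in `[0, ∞]`. -/
def IsORV (μ : Measure ℝ) (r : ℝ) : Prop :=
  ∃ c₁ c₂ : ℝ, 0 < c₁ ∧ 0 < c₂ ∧ ∀ c : ℝ, 1 ≤ c →
    ENNReal.ofReal (c₁ * c ^ r) < liminf (fun x : ℝ => μ (Ioi (c * x)) / μ (Ioi x)) atTop ∧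
    limsup (fun x : ℝ => μ (Ioi (c * x)) / μ (Ioi x)) atTop < ENNReal.ofReal (c₂ * c ^ r)

/-- The `k`-th order statistic (the `k`-th smallest entry, `1 ≤ k ≤ n`) of `x₁, …, xₙ`; the value
is `0` for the other `k`. -/
def orderStat {n : ℕ} (k : ℕ) (x : Fin n → ℝ) : ℝ :=
  if h : 1 ≤ k ∧ k ≤ n then x (Tuple.sort x ⟨k - 1, by omega⟩) else 0

/-- Waiting time `W_(nJ)` of a job that finds the workloads `v` and whose `nF` replicas are sent to
the servers `s`: the replica at server `s l` has waiting time `v (s l)`. -/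
def waitingTime {N nF : ℕ} (nJ : ℕ) (v : Fin N → ℝ) (s : Fin nF → Fin N) : ℝ :=
  orderStat nJ (fun l => v (s l))

/-- Response time `R = (W + B)_(nJ)` of a job that finds the workloads `v`, and whose replicas have
sizes `b` and are sent to the servers `s`: the time until `nJ` of its replicas are completed. -/
def responseTime {N nF : ℕ} (nJ : ℕ) (v : Fin N → ℝ) (s : Fin nF → Fin N) (b : Fin nF → ℝ) : ℝ :=
  orderStat nJ (fun l => v (s l) + b l)

/-- Workloads (time until idle in the absence of further arrivals) directly after the arrival of
that job, under FCFS with cancellation on completion. The replica at server `s l` would be served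
during the period from `v (s l)` to `v (s l) + b l`; it is removed at time `responseTime`, so this
service is cut short if it is in progress then, and does not take place if it has not begun. -/
def workloadAfter {N nF : ℕ} (nJ : ℕ) (v : Fin N → ℝ) (s : Fin nF → Fin N) (b : Fin nF → ℝ) :
    Fin N → ℝ :=
  Function.extend s
    (fun l => min (v (s l) + b l) (max (v (s l)) (responseTime nJ v s b))) v

/-- Workloads found by the next job, which arrives `a` time units later. -/
def nextWorkload {N nF : ℕ} (nJ : ℕ) (v : Fin N → ℝ) (s : Fin nF → Fin N) (b : Fin nF → ℝ)
    (a : ℝ) : Fin N → ℝ :=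
  fun i => max (workloadAfter nJ v s b i - a) 0

/-- Joint law of (servers, replica sizes, time until the next arrival) of a job: the three are
independent, and the `nF` servers are drawn uniformly without replacement from the `N` servers. -/
def jobLaw (N : ℕ) {nF : ℕ} (lawA : Measure ℝ) (lawB : Measure (Fin nF → ℝ)) :
    Measure ((Fin nF → Fin N) × (Fin nF → ℝ) × ℝ) :=
  (ProbabilityTheory.uniformOn {s : Fin nF → Fin N | Function.Injective s}).prod (lawB.prod lawA)

/-- `π` is a steady-state law of the workloads found by an arriving job: a probability measure that
is stationary for the Markov chain of the workloads at the successive arrival epochs. -/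
def IsSteadyState {N nF : ℕ} (nJ : ℕ) (lawA : Measure ℝ) (lawB : Measure (Fin nF → ℝ))
    (π : Measure (Fin N → ℝ)) : Prop :=
  IsProbabilityMeasure π ∧
    (π.prod (jobLaw N lawA lawB)).map (fun p => nextWorkload nJ p.1 p.2.1 p.2.2.1 p.2.2.2) = π

/-- Law of `W_(nJ)` when the workloads found by the arriving job have law `π`. -/
def waitingLaw {N nF : ℕ} (nJ : ℕ) (lawA : Measure ℝ) (lawB : Measure (Fin nF → ℝ))
    (π : Measure (Fin N → ℝ)) : Measure ℝ :=
  (π.prod (jobLaw N lawA lawB)).map (fun p => waitingTime nJ p.1 p.2.1)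

/-- Law of `R` when the workloads found by the arriving job have law `π`. -/
def responseLaw {N nF : ℕ} (nJ : ℕ) (lawA : Measure ℝ) (lawB : Measure (Fin nF → ℝ))
    (π : Measure (Fin N → ℝ)) : Measure ℝ :=
  (π.prod (jobLaw N lawA lawB)).map (fun p => responseTime nJ p.1 p.2.1 p.2.2.1)

/-- The load `ρ_U = E[B_(nJ)] / E[A]`. -/
def rhoU {nF : ℕ} (nJ : ℕ) (lawA : Measure ℝ) (lawB : Measure (Fin nF → ℝ)) : ℝ :=
  (∫ b, orderStat nJ b ∂lawB) / ∫ a, a ∂lawA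

end ForkJoin

end

namespace ForkJoin

lemma card_lt_add_card_le {n : ℕ} (x : Fin n → ℝ) (t : ℝ) :
    Fintype.card {l // t < x l} + Fintype.card {l // x l ≤ t} = n := by
  have h := Fintype.card_subtype_compl (fun l => x l ≤ t)
  have h2 := Fintype.card_subtype_le (fun l => x l ≤ t)
  simp only [not_le, Fintype.card_fin] at h h2
  omega

/-- An order statistic is at most `t` iff enough entries are at most `t`. -/
lemma orderStat_le_iff {n k : ℕ} (h1 : 1 ≤ k) (h2 : k ≤ n) (x : Fin n → ℝ) (t : ℝ) :
    orderStat k x ≤ t ↔ k ≤ Fintype.card {l // x l ≤ t} := by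
  have hm := Tuple.monotone_sort x
  have hc : Fintype.card {l // x l ≤ t}
      = (Finset.univ.filter fun l => (x ∘ Tuple.sort x) l ≤ t).card := by
    rw [← Fintype.card_subtype]
    exact Fintype.card_congr ((Tuple.sort x).symm.subtypeEquiv fun a => by simp)
  have key : k - 1 < (Finset.univ.filter fun l => (x ∘ Tuple.sort x) l ≤ t).card
      ↔ x (Tuple.sort x ⟨k - 1, by omega⟩) ≤ t :=
    Tuple.lt_card_le_iff_apply_le_of_monotone (j := ⟨k - 1, by omega⟩) hm
  rw [orderStat, dif_pos ⟨h1, h2⟩, ← key, ← hc]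
  omega

lemma lt_orderStat_iff {n k : ℕ} (h1 : 1 ≤ k) (h2 : k ≤ n) (x : Fin n → ℝ) (t : ℝ) :
    t < orderStat k x ↔ n < k + Fintype.card {l // t < x l} := by
  have := orderStat_le_iff h1 h2 x t
  have h3 := card_lt_add_card_le x t
  rw [← not_le, this]
  omega

lemma orderStat_eq_of_not {n k : ℕ} (h : ¬ (1 ≤ k ∧ k ≤ n)) (x : Fin n → ℝ) :
    orderStat k x = 0 := by simp [orderStat, h]

lemma orderStat_mono {n : ℕ} (k : ℕ) : Monotone (orderStat k : (Fin n → ℝ) → ℝ) := by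
  intro x y hxy
  by_cases h : 1 ≤ k ∧ k ≤ n
  · rw [orderStat_le_iff h.1 h.2]
    refine ((orderStat_le_iff h.1 h.2 y _).1 le_rfl).trans ?_
    exact Fintype.card_subtype_mono _ _ fun l (hl : y l ≤ _) => (hxy l).trans hl
  · simp [orderStat_eq_of_not h]

lemma orderStat_mem {n k : ℕ} (h1 : 1 ≤ k) (h2 : k ≤ n) (x : Fin n → ℝ) :
    ∃ l, orderStat k x = x l := by
  simp only [orderStat, h1, h2, and_self, dif_pos]
  exact ⟨_, rfl⟩

lemma orderStat_add_const {n k : ℕ} (h1 : 1 ≤ k) (h2 : k ≤ n) (x : Fin n → ℝ) (c : ℝ) :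
    orderStat k (fun l => x l + c) = orderStat k x + c := by
  refine eq_of_forall_ge_iff fun t => ?_
  rw [orderStat_le_iff h1 h2, ← le_sub_iff_add_le, orderStat_le_iff h1 h2]
  simp only [le_sub_iff_add_le]

lemma lipschitz_orderStat {n : ℕ} (k : ℕ) :
    LipschitzWith 1 (orderStat k : (Fin n → ℝ) → ℝ) := by
  refine LipschitzWith.of_le_add fun x y => ?_
  by_cases h : 1 ≤ k ∧ k ≤ n
  · rw [← orderStat_add_const h.1 h.2]
    refine orderStat_mono k fun l => ?_
    have := dist_le_pi_dist x y l
    rw [Real.dist_eq] at this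
    linarith [le_abs_self (x l - y l)]
  · simp [orderStat_eq_of_not h]

lemma continuous_orderStat {n : ℕ} (k : ℕ) : Continuous (orderStat k : (Fin n → ℝ) → ℝ) :=
  (lipschitz_orderStat k).continuous

lemma orderStat_nonneg {n : ℕ} (k : ℕ) {x : Fin n → ℝ} (hx : ∀ l, 0 ≤ x l) :
    0 ≤ orderStat k x := by
  by_cases h : 1 ≤ k ∧ k ≤ n
  · obtain ⟨l, hl⟩ := orderStat_mem h.1 h.2 x
    exact hl ▸ hx l
  · simp [orderStat_eq_of_not h]

lemma orderStat_of_monotone {n k : ℕ} (h1 : 1 ≤ k) (h2 : k ≤ n) {x : Fin n → ℝ}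
    (hx : Monotone x) : orderStat k x = x ⟨k - 1, by omega⟩ := by
  simp [orderStat, h1, h2, Tuple.sort_eq_refl_iff_monotone.2 hx]

section dynamics

variable {N nF nJ : ℕ}

lemma responseTime_mono (s : Fin nF → Fin N) (b : Fin nF → ℝ) :
    Monotone fun v => responseTime nJ v s b := fun v w hvw =>
  orderStat_mono _ fun l => by have := hvw (s l); simpa using this

lemma workloadAfter_cases (s : Fin nF → Fin N) (i : Fin N) :
    (∃ l, s l = i ∧ ∀ v b, workloadAfter nJ v s b i
      = min (v i + b l) (max (v i) (responseTime nJ v s b))) ∨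
    ((∀ l, s l ≠ i) ∧ ∀ v b, workloadAfter nJ v s b i = v i) := by
  classical
  by_cases h : ∃ l, s l = i
  · left
    refine ⟨h.choose, h.choose_spec, fun v b => ?_⟩
    simp only [workloadAfter, Function.extend_def, dif_pos h]
    rw [h.choose_spec]
  · right
    refine ⟨fun l hl => h ⟨l, hl⟩, fun v b => ?_⟩
    simp [workloadAfter, Function.extend_def, dif_neg h]

lemma nextWorkload_mono (s : Fin nF → Fin N) (b : Fin nF → ℝ) (a : ℝ) :
    Monotone fun v => nextWorkload nJ v s b a := by
  intro v w hvw i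
  have hR := responseTime_mono (nJ := nJ) s b hvw
  have hi := hvw i
  have : workloadAfter nJ v s b i ≤ workloadAfter nJ w s b i := by
    rcases workloadAfter_cases (nJ := nJ) s i with ⟨l, -, hl⟩ | ⟨-, hl⟩
    · rw [hl, hl]
      exact min_le_min (by linarith) (max_le_max hi hR)
    · rw [hl, hl]; exact hi
  simp only [nextWorkload]
  exact max_le_max (by linarith) le_rfl

lemma nextWorkload_nonneg (v : Fin N → ℝ) (s : Fin nF → Fin N) (b : Fin nF → ℝ) (a : ℝ)
    (i : Fin N) : 0 ≤ nextWorkload nJ v s b a i := le_max_right _ _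

lemma continuous_responseTime (s : Fin nF → Fin N) :
    Continuous fun p : (Fin N → ℝ) × (Fin nF → ℝ) => responseTime nJ p.1 s p.2 := by
  unfold responseTime
  exact (continuous_orderStat nJ).comp (by fun_prop)

lemma continuous_nextWorkload (s : Fin nF → Fin N) :
    Continuous fun p : (Fin N → ℝ) × (Fin nF → ℝ) × ℝ => nextWorkload nJ p.1 s p.2.1 p.2.2 := by
  have hR : Continuous fun p : (Fin N → ℝ) × (Fin nF → ℝ) × ℝ => responseTime nJ p.1 s p.2.1 :=
    (continuous_responseTime s).comp
      (by fun_prop : Continuous fun p : (Fin N → ℝ) × (Fin nF → ℝ) × ℝ => (p.1, p.2.1))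
  refine continuous_pi fun i => ?_
  simp only [nextWorkload]
  rcases workloadAfter_cases (nJ := nJ) s i with ⟨l, -, hl⟩ | ⟨-, hl⟩
  · simp only [hl]; fun_prop
  · simp only [hl]; fun_prop

/-- Measurability in a product with a countable discrete factor, one section at a time. -/
lemma measurable_of_sections {α β γ δ : Type*} [MeasurableSpace α] [MeasurableSpace β]
    [Countable β] [MeasurableSingletonClass β] [MeasurableSpace γ] [MeasurableSpace δ]
    {f : α × β × γ → δ} (hf : ∀ s, Measurable fun p : α × γ => f (p.1, s, p.2)) :
    Measurable f := by
  have h : Measurable fun q : (α × γ) × β => f (q.1.1, q.2, q.1.2) :=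
    measurable_from_prod_countable_left fun s => hf s
  exact h.comp (by fun_prop : Measurable fun p : α × β × γ => (((p.1, p.2.2), p.2.1) : (α × γ) × β))

lemma measurable_nextWorkload :
    Measurable fun p : (Fin N → ℝ) × (Fin nF → Fin N) × (Fin nF → ℝ) × ℝ =>
      nextWorkload nJ p.1 p.2.1 p.2.2.1 p.2.2.2 :=
  measurable_of_sections fun s => (continuous_nextWorkload s).measurable

lemma measurable_responseTime :
    Measurable fun p : (Fin N → ℝ) × (Fin nF → Fin N) × (Fin nF → ℝ) × ℝ =>
      responseTime nJ p.1 p.2.1 p.2.2.1 :=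
  measurable_of_sections fun s => (continuous_responseTime s).measurable.comp
    (by fun_prop : Measurable fun p : (Fin N → ℝ) × (Fin nF → ℝ) × ℝ => (p.1, p.2.1))

lemma measurable_waitingTime :
    Measurable fun p : (Fin N → ℝ) × (Fin nF → Fin N) × (Fin nF → ℝ) × ℝ =>
      waitingTime nJ p.1 p.2.1 := by
  refine measurable_of_sections fun s => ?_
  exact ((continuous_orderStat nJ).comp (continuous_pi fun l =>
    (continuous_apply (s l)).comp continuous_fst)).measurable

/-- The largest workload. -/
noncomputable def maxLoad (v : Fin N → ℝ) : ℝ := orderStat N v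

lemma le_maxLoad (v : Fin N → ℝ) (i : Fin N) : v i ≤ maxLoad v := by
  have hN : 1 ≤ N := i.pos
  have h := (orderStat_le_iff hN le_rfl v _).1 (le_refl (maxLoad v))
  have h2 := card_lt_add_card_le v (maxLoad v)
  have h3 : Fintype.card {l // maxLoad v < v l} = 0 := by omega
  rw [Fintype.card_eq_zero_iff] at h3
  by_contra hi
  exact h3.elim ⟨i, not_le.1 hi⟩

lemma maxLoad_le {v : Fin N → ℝ} {t : ℝ} (hN : 1 ≤ N) (h : ∀ i, v i ≤ t) : maxLoad v ≤ t := by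
  obtain ⟨l, hl⟩ := orderStat_mem hN le_rfl v
  exact (show maxLoad v = v l from hl) ▸ h l

lemma waitingTime_le_responseTime (v : Fin N → ℝ) (s : Fin nF → Fin N) {b : Fin nF → ℝ}
    (hb : ∀ l, 0 ≤ b l) : waitingTime nJ v s ≤ responseTime nJ v s b :=
  orderStat_mono _ fun l => by have := hb l; simpa using this

lemma responseTime_le (hJ : 1 ≤ nJ) (hJF : nJ ≤ nF) (v : Fin N → ℝ) (s : Fin nF → Fin N)
    (b : Fin nF → ℝ) : responseTime nJ v s b ≤ maxLoad v + orderStat nJ b := by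
  rw [add_comm, ← orderStat_add_const hJ hJF]
  exact orderStat_mono _ fun l => by have := le_maxLoad v (s l); simp only; linarith

lemma orderStat_le_responseTime (s : Fin nF → Fin N) {v : Fin N → ℝ} (hv : ∀ i, 0 ≤ v i)
    (b : Fin nF → ℝ) : orderStat nJ b ≤ responseTime nJ v s b :=
  orderStat_mono _ fun l => by have := hv (s l); simpa using this

lemma maxLoad_nextWorkload_le (hN : 1 ≤ N) (hJ : 1 ≤ nJ) (hJF : nJ ≤ nF) (v : Fin N → ℝ)
    (s : Fin nF → Fin N) {b : Fin nF → ℝ} (hb : ∀ l, 0 ≤ b l) (a : ℝ) :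
    maxLoad (nextWorkload nJ v s b a) ≤ max (maxLoad v + (orderStat nJ b - a)) 0 := by
  refine maxLoad_le hN fun i => max_le_max ?_ le_rfl
  have hB := orderStat_nonneg nJ hb
  have hR := responseTime_le hJ hJF v s b
  have hi := le_maxLoad v i
  have : workloadAfter nJ v s b i ≤ maxLoad v + orderStat nJ b := by
    rcases workloadAfter_cases (nJ := nJ) s i with ⟨l, -, hl⟩ | ⟨-, hl⟩
    · rw [hl]
      exact (min_le_right _ _).trans (max_le (by linarith) hR)
    · rw [hl]; linarith
  linarith

/-- The `(nF - nJ + 1)`-th largest workload. -/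
noncomputable def topLoad (nF nJ : ℕ) {N : ℕ} (v : Fin N → ℝ) : ℝ := orderStat (N - nF + nJ) v

lemma le_topLoad_nextWorkload (hJ : 1 ≤ nJ) (hJF : nJ ≤ nF) (hFN : nF ≤ N) {v : Fin N → ℝ}
    (hv : ∀ i, 0 ≤ v i) {s : Fin nF → Fin N} (hs : Function.Injective s) {b : Fin nF → ℝ}
    (hb : ∀ l, 0 ≤ b l) (a : ℝ) :
    max (topLoad nF nJ v) (orderStat nJ b) - a ≤ topLoad nF nJ (nextWorkload nJ v s b a) := by
  have h1 : 1 ≤ N - nF + nJ := by omega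
  have h2 : N - nF + nJ ≤ N := by omega
  rw [sub_le_iff_le_add]
  refine max_le ?_ ?_
  · rw [topLoad, topLoad, ← orderStat_add_const h1 h2]
    refine orderStat_mono _ fun i => ?_
    have : v i ≤ workloadAfter nJ v s b i := by
      rcases workloadAfter_cases (nJ := nJ) s i with ⟨l, -, hl⟩ | ⟨-, hl⟩
      · rw [hl]
        exact le_min (by linarith [hb l]) (le_max_left _ _)
      · rw [hl]
    have h3 : workloadAfter nJ v s b i - a ≤ nextWorkload nJ v s b a i := le_max_left _ _
    simp only
    linarith
  · rw [← sub_le_iff_le_add]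
    refine le_of_forall_lt fun t ht => ?_
    rw [topLoad, lt_orderStat_iff h1 h2]
    have hB := (lt_orderStat_iff hJ hJF b (t + a)).1 (by linarith)
    have hR := orderStat_le_responseTime (nJ := nJ) s hv b
    have hcard : Fintype.card {l // t + a < b l}
        ≤ Fintype.card {i // t < nextWorkload nJ v s b a i} := by
      refine Fintype.card_le_of_injective
        (fun l => ⟨s l.1, ?_⟩) (fun l m hlm => ?_)
      · obtain ⟨l, hl⟩ := l
        have : t + a < workloadAfter nJ v s b (s l) := by
          rcases workloadAfter_cases (nJ := nJ) s (s l) with ⟨m, hm, hm'⟩ | ⟨hm, -⟩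
          · rw [hm', hs hm]
            have := hv (s l)
            exact lt_min (by linarith) (lt_max_of_lt_right (by linarith))
          · exact absurd rfl (hm l)
        exact lt_max_of_lt_left (by linarith)
      · exact Subtype.ext (hs (congrArg Subtype.val hlm))
    omega

/-- If the selected servers are the `nF` ones with the largest workloads, the waiting time is
`topLoad`. -/
lemma exists_waitingTime_eq_topLoad (hJ : 1 ≤ nJ) (hJF : nJ ≤ nF) (hFN : nF ≤ N)
    (v : Fin N → ℝ) :
    ∃ s : Fin nF → Fin N, Function.Injective s ∧ waitingTime nJ v s = topLoad nF nJ v := by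
  refine ⟨fun l => Tuple.sort v ⟨N - nF + l, by omega⟩, fun l m h => ?_, ?_⟩
  · have := (Tuple.sort v).injective h
    simp only [Fin.mk.injEq] at this
    exact Fin.ext (by omega)
  · have hm : Monotone fun l : Fin nF => v (Tuple.sort v ⟨N - nF + l, by omega⟩) :=
      fun l m hlm => Tuple.monotone_sort v (by simpa using hlm)
    rw [waitingTime, orderStat_of_monotone hJ hJF hm, topLoad, orderStat, dif_pos (by omega)]
    congr 3
    simp only
    omega

end dynamics

/-- The slope at `u` of the test function `ramp a`. -/
noncomputable def rampSlope (a u : ℝ) : ℝ := max 0 (min ((u - a) / a) 1)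

/-- A smoothed positive part: zero up to `a`, quadratic up to `2 a`, then linear with slope one. -/
noncomputable def ramp (a u : ℝ) : ℝ := rampSlope a u * (u - a) - a * rampSlope a u ^ 2 / 2

section ramp

variable {a : ℝ}

lemma rampSlope_nonneg (a u : ℝ) : 0 ≤ rampSlope a u := le_max_left _ _

lemma rampSlope_le_one (a u : ℝ) : rampSlope a u ≤ 1 := max_le zero_le_one (min_le_right _ _)

lemma rampSlope_of_le (ha : 0 < a) {u : ℝ} (h : u ≤ a) : rampSlope a u = 0 :=
  max_eq_left ((min_le_left _ _).trans (div_nonpos_of_nonpos_of_nonneg (by linarith) ha.le))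

lemma rampSlope_of_ge (ha : 0 < a) {u : ℝ} (h : 2 * a ≤ u) : rampSlope a u = 1 := by
  have : 1 ≤ (u - a) / a := by rw [le_div_iff₀ ha]; linarith
  simp [rampSlope, min_eq_right this]

lemma rampSlope_of_mem (ha : 0 < a) {u : ℝ} (h : a ≤ u) (h' : u ≤ 2 * a) :
    rampSlope a u = (u - a) / a := by
  have h1 : (u - a) / a ≤ 1 := by rw [div_le_iff₀ ha]; linarith
  have h2 : 0 ≤ (u - a) / a := div_nonneg (by linarith) ha.le
  simp [rampSlope, min_eq_left h1, max_eq_right h2]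

lemma continuous_rampSlope (a : ℝ) : Continuous (rampSlope a) := by
  unfold rampSlope
  exact continuous_const.max (((continuous_id.sub continuous_const).div_const a).min
    continuous_const)

lemma continuous_ramp (a : ℝ) : Continuous (ramp a) := by
  have := continuous_rampSlope a
  unfold ramp
  fun_prop

lemma abs_rampSlope_sub_le (ha : 0 < a) (u v : ℝ) :
    |rampSlope a u - rampSlope a v| ≤ min 1 (|u - v| / a) := by
  refine le_min ?_ ?_
  · rw [abs_le]
    constructor <;> linarith [rampSlope_nonneg a u, rampSlope_nonneg a v, rampSlope_le_one a u,
      rampSlope_le_one a v]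
  · have h1 := abs_max_sub_max_le_max 0 (min ((u - a) / a) 1) 0 (min ((v - a) / a) 1)
    have h2 := abs_min_sub_min_le_max ((u - a) / a) 1 ((v - a) / a) 1
    have h3 : |(u - a) / a - (v - a) / a| = |u - v| / a := by
      rw [← sub_div, abs_div, abs_of_pos ha]; congr 2; ring
    rw [sub_self, abs_zero] at h1 h2
    rw [h3] at h2
    have h4 : 0 ≤ |u - v| / a := by positivity
    rw [max_eq_left h4] at h2
    exact h1.trans (max_le h4 h2)

/-- `ramp a` is the convex conjugate of a quadratic on `[0, 1]`. -/
lemma le_ramp (ha : 0 < a) {t : ℝ} (h0 : 0 ≤ t) (h1 : t ≤ 1) (u : ℝ) :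
    t * (u - a) - a * t ^ 2 / 2 ≤ ramp a u := by
  unfold ramp
  rcases le_total u a with h | h
  · rw [rampSlope_of_le ha h]
    nlinarith [mul_nonneg h0 (sub_nonneg.2 h), mul_nonneg ha.le (sq_nonneg t)]
  rcases le_total u (2 * a) with h' | h'
  · rw [rampSlope_of_mem ha h h']
    have : (u - a) / a * (u - a) - a * ((u - a) / a) ^ 2 / 2 - (t * (u - a) - a * t ^ 2 / 2)
        = a * ((u - a) / a - t) ^ 2 / 2 := by field_simp; ring
    have h3 : 0 ≤ a * ((u - a) / a - t) ^ 2 / 2 := by positivity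
    linarith
  · rw [rampSlope_of_ge ha h']
    nlinarith [mul_nonneg (sub_nonneg.2 h1) (sub_nonneg.2 h'),
      mul_nonneg ha.le (sq_nonneg (1 - t))]

lemma ramp_nonneg (ha : 0 < a) (u : ℝ) : 0 ≤ ramp a u := by
  simpa using le_ramp ha le_rfl zero_le_one u

lemma ramp_of_le (ha : 0 < a) {u : ℝ} (h : u ≤ a) : ramp a u = 0 := by
  simp [ramp, rampSlope_of_le ha h]

lemma ramp_mono (ha : 0 < a) : Monotone (ramp a) := fun u v huv => by
  refine le_trans ?_ (le_ramp ha (rampSlope_nonneg a u) (rampSlope_le_one a u) v)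
  have := mul_le_mul_of_nonneg_left huv (rampSlope_nonneg a u)
  unfold ramp
  linarith

lemma ramp_le (ha : 0 < a) (u : ℝ) : ramp a u ≤ max (u - a) 0 := by
  have h2 : 0 ≤ a * rampSlope a u ^ 2 / 2 := by positivity
  have h3 : rampSlope a u * (u - a) ≤ max (u - a) 0 := by
    rcases le_total u a with h | h
    · simp [rampSlope_of_le ha h]
    · exact (mul_le_of_le_one_left (by linarith) (rampSlope_le_one a u)).trans (le_max_left _ _)
  unfold ramp
  linarith

lemma ramp_add_le (ha : 0 < a) (u x : ℝ) :
    ramp a (u + x) ≤ ramp a u + rampSlope a u * x + |x| * min 1 (|x| / a) := by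
  have h1 := le_ramp ha (rampSlope_nonneg a (u + x)) (rampSlope_le_one a (u + x)) u
  have h2 := abs_rampSlope_sub_le ha (u + x) u
  rw [add_sub_cancel_left] at h2
  have h3 : (rampSlope a (u + x) - rampSlope a u) * x ≤ |x| * min 1 (|x| / a) := by
    refine (le_abs_self _).trans ?_
    rw [abs_mul, mul_comm]
    exact mul_le_mul_of_nonneg_left h2 (abs_nonneg x)
  have h4 : ramp a (u + x) = rampSlope a (u + x) * (u - a) - a * rampSlope a (u + x) ^ 2 / 2
    + rampSlope a (u + x) * x := by unfold ramp; ring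
  linarith

end ramp

section limits

variable {Ω : Type*} [MeasurableSpace Ω] {P : Measure Ω}

/-- The truncated first moment vanishes as the truncation level grows. -/
lemma tendsto_integral_mul_min {X : Ω → ℝ} (hX : Integrable X P) :
    Tendsto (fun a : ℝ => ∫ ω, |X ω| * min 1 (|X ω| / a) ∂P) atTop (nhds 0) := by
  suffices h : Tendsto (fun a : ℝ => ∫ ω, |X ω| * min 1 (|X ω| / a) ∂P) atTop
      (nhds (∫ _, 0 ∂P)) by rwa [integral_zero] at h
  refine tendsto_integral_filter_of_dominated_convergence (fun ω => |X ω|) ?_ ?_ hX.abs ?_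
  · refine Eventually.of_forall fun a => ?_
    have := hX.1.aemeasurable
    exact AEMeasurable.aestronglyMeasurable (by fun_prop)
  · filter_upwards [eventually_gt_atTop 0] with a ha
    refine ae_of_all _ fun ω => ?_
    rw [Real.norm_eq_abs, abs_of_nonneg (by positivity)]
    exact mul_le_of_le_one_right (abs_nonneg _) (min_le_left _ _)
  · refine ae_of_all _ fun ω => ?_
    have h1 : Tendsto (fun a : ℝ => |X ω| / a) atTop (nhds 0) := tendsto_const_nhds.div_atTop tendsto_id
    have h2 := ((tendsto_const_nhds (x := (1 : ℝ))).min h1).const_mul |X ω|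
    simpa using h2

lemma tendsto_integral_excess {X : Ω → ℝ} (hX : Integrable X P) :
    Tendsto (fun a : ℝ => ∫ ω, max (X ω - a) 0 ∂P) atTop (nhds 0) := by
  suffices h : Tendsto (fun a : ℝ => ∫ ω, max (X ω - a) 0 ∂P) atTop
      (nhds (∫ _, 0 ∂P)) by rwa [integral_zero] at h
  refine tendsto_integral_filter_of_dominated_convergence (fun ω => |X ω|) ?_ ?_ hX.abs ?_
  · refine Eventually.of_forall fun a => ?_
    have := hX.1.aemeasurable
    exact AEMeasurable.aestronglyMeasurable (by fun_prop)
  · filter_upwards [eventually_ge_atTop 0] with a ha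
    refine ae_of_all _ fun ω => ?_
    rw [Real.norm_eq_abs, abs_of_nonneg (le_max_right _ _)]
    exact max_le (by linarith [le_abs_self (X ω)]) (abs_nonneg _)
  · refine ae_of_all _ fun ω => ?_
    refine tendsto_const_nhds.congr' ?_
    filter_upwards [eventually_ge_atTop (X ω)] with a ha
    exact (max_eq_right (by linarith)).symm

end limits

section drift

variable {Ω : Type*} [MeasurableSpace Ω] {P : Measure Ω} [IsProbabilityMeasure P]

/-- `M` is stochastically smaller than `M'`. -/
def StochLE (P : Measure Ω) (M M' : Ω → ℝ) : Prop :=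
  ∀ g : ℝ → ℝ, Continuous g → Monotone g → (∃ C, ∀ x, |g x| ≤ C) →
    ∫ ω, g (M ω) ∂P ≤ ∫ ω, g (M' ω) ∂P

lemma integrable_bdd_comp {M : Ω → ℝ} (hM : Measurable M) {g : ℝ → ℝ} (hg : Measurable g) {C : ℝ}
    (hC : ∀ x, |g x| ≤ C) : Integrable (fun ω => g (M ω)) P :=
  Integrable.of_bound (hg.comp hM).aestronglyMeasurable C (ae_of_all _ fun _ => hC _)

lemma tendsto_tail {M : Ω → ℝ} (hM : Measurable M) :
    Tendsto (fun z : ℝ => P.real {ω | z < M ω}) atTop (nhds 0) := by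
  have hp : IsProbabilityMeasure (P.map M) := Measure.isProbabilityMeasure_map hM.aemeasurable
  have h := (ProbabilityTheory.tendsto_cdf_atTop (P.map M)).const_sub 1
  rw [sub_self] at h
  refine h.congr fun z => ?_
  rw [ProbabilityTheory.cdf_eq_real, ← probReal_compl_eq_one_sub measurableSet_Iic,
    map_measureReal_apply hM measurableSet_Iic.compl]
  congr 1
  ext ω
  simp

lemma integral_le_one_mul_real {g : Ω → ℝ} {s : Set Ω} (hs : MeasurableSet s)
    (hg : Integrable g P) (h : ∀ ω, s.indicator 1 ω ≤ g ω) : P.real s ≤ ∫ ω, g ω ∂P := by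
  rw [← integral_indicator_one hs]
  exact integral_mono ((integrable_const 1).indicator hs) hg h

/-- Tail estimate for a random variable `M` that is not stochastically decreased by a reflected step
`X` of negative mean. -/
lemma drift_tail_le {M M' X : Ω → ℝ} (hM : Measurable M) (hM' : Measurable M') (hXm : Measurable X)
    (hX : Integrable X P) (hind : ProbabilityTheory.IndepFun M X P)
    (hstep : ∀ᵐ ω ∂P, M' ω ≤ max (M ω + X ω) 0) (hord : StochLE P M M') {a : ℝ} (ha : 0 < a) :
    (-∫ ω, X ω ∂P) * P.real {ω | 2 * a < M ω} ≤
      (∫ ω, max (X ω - a / 2) 0 ∂P)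
        + (∫ ω, |X ω| * min 1 (|X ω| / a) ∂P) * P.real {ω | a / 2 < M ω} := by
  set δ := -∫ ω, X ω ∂P with hδ
  by_cases hδ0 : δ ≤ 0
  · have h1 : δ * P.real {ω | 2 * a < M ω} ≤ 0 :=
      mul_nonpos_of_nonpos_of_nonneg hδ0 measureReal_nonneg
    have h2 : 0 ≤ ∫ ω, max (X ω - a / 2) 0 ∂P := integral_nonneg fun _ => le_max_right _ _
    have h3 : 0 ≤ ∫ ω, |X ω| * min 1 (|X ω| / a) ∂P := integral_nonneg fun _ => by
      positivity
    have := mul_nonneg h3 (measureReal_nonneg (μ := P) (s := {ω | a / 2 < M ω}))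
    linarith
  push Not at hδ0
  set ψ : Ω → ℝ := fun ω => |X ω| * min 1 (|X ω| / a) with hψ
  set s : Set Ω := {ω | a / 2 < M ω}
  have hs : MeasurableSet s := measurableSet_lt measurable_const hM
  have hψi : Integrable ψ P := by
    refine hX.abs.mono' (by fun_prop) (ae_of_all _ fun ω => ?_)
    have h0 : 0 ≤ min 1 (|X ω| / a) := by positivity
    rw [hψ, Real.norm_eq_abs, abs_of_nonneg (by positivity)]
    exact mul_le_of_le_one_right (abs_nonneg _) (min_le_left _ _)
  have hpi : Integrable (fun ω => max (X ω - a / 2) 0) P := (hX.sub (integrable_const _)).pos_part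
  -- the estimate for the truncated test function
  have key : ∀ Z : ℝ, 2 * a ≤ Z → δ * P.real {ω | 2 * a < M ω ∧ M ω ≤ Z} ≤
      (∫ ω, max (X ω - a / 2) 0 ∂P) + (∫ ω, ψ ω ∂P) * P.real s := by
    intro Z hZ
    set f : ℝ → ℝ := fun m => min (ramp a m) (ramp a Z) with hf
    have hfc : Continuous f := (continuous_ramp a).min continuous_const
    have hfm : Monotone f := fun u v h => min_le_min (ramp_mono ha h) le_rfl
    have hfb : ∀ x, |f x| ≤ ramp a Z := fun x => by
      rw [abs_of_nonneg (le_min (ramp_nonneg ha _) (ramp_nonneg ha _))]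
      exact min_le_right _ _
    set g : ℝ → ℝ := (Iic Z).indicator (rampSlope a) with hg
    have hgm : Measurable g := (continuous_rampSlope a).measurable.indicator measurableSet_Iic
    have hg0 : ∀ x, 0 ≤ g x := fun x => indicator_nonneg (fun _ _ => rampSlope_nonneg a _) x
    have hg1 : ∀ x, |g x| ≤ 1 := fun x => by
      rw [abs_of_nonneg (hg0 x)]
      exact (indicator_le_self' (fun _ _ => rampSlope_nonneg a _) x).trans (rampSlope_le_one a x)
    have hgi : Integrable (fun ω => g (M ω)) P := integrable_bdd_comp hM hgm hg1
    have hind' : ProbabilityTheory.IndepFun (fun ω => g (M ω)) X P :=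
      hind.comp hgm measurable_id
    have hgX : Integrable (fun ω => g (M ω) * X ω) P := hind'.integrable_mul hgi hX
    have hsind : Integrable (fun ω => s.indicator (1 : Ω → ℝ) ω * ψ ω) P := by
      have : (fun ω => s.indicator (1 : Ω → ℝ) ω * ψ ω) = s.indicator ψ := by
        ext ω; by_cases h : ω ∈ s <;> simp [h]
      rw [this]; exact hψi.indicator hs
    have hpt : ∀ᵐ ω ∂P, f (M' ω) ≤ f (M ω) + (g (M ω) * X ω
        + (s.indicator (1 : Ω → ℝ) ω * ψ ω + max (X ω - a / 2) 0)) := by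
      filter_upwards [hstep] with ω hω
      have hψ0 : 0 ≤ ψ ω := by rw [hψ]; positivity
      have hp0 : 0 ≤ max (X ω - a / 2) 0 := le_max_right _ _
      have hs0 : 0 ≤ s.indicator (1 : Ω → ℝ) ω :=
        indicator_nonneg (fun _ _ => zero_le_one) _
      by_cases hMZ : M ω ≤ Z
      · have h1 : f (M ω) = ramp a (M ω) := min_eq_left (ramp_mono ha hMZ)
        have h2 : f (M' ω) ≤ ramp a (M ω + X ω) := by
          refine (min_le_left _ _).trans ((ramp_mono ha hω).trans ?_)
          rw [(ramp_mono ha).map_max, ramp_of_le ha ha.le]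
          exact max_le le_rfl (ramp_nonneg ha _)
        have h3 : g (M ω) = rampSlope a (M ω) := indicator_of_mem (show M ω ∈ Iic Z from hMZ) _
        rw [h1, h3]
        by_cases hsω : ω ∈ s
        · rw [indicator_of_mem hsω]
          have := ramp_add_le ha (M ω) (X ω)
          simp only [Pi.one_apply, one_mul]
          linarith
        · rw [indicator_of_notMem hsω]
          have hle : M ω ≤ a / 2 := not_lt.1 hsω
          rw [rampSlope_of_le ha (by linarith)]
          have h4 := ramp_le ha (M ω + X ω)
          have h5 : max (M ω + X ω - a) 0 ≤ max (X ω - a / 2) 0 :=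
            max_le_max (by linarith) le_rfl
          have := ramp_nonneg ha (M ω)
          linarith
      · have h1 : f (M ω) = ramp a Z := min_eq_right (ramp_mono ha (not_le.1 hMZ).le)
        have h2 : f (M' ω) ≤ ramp a Z := min_le_right _ _
        have h3 : g (M ω) = 0 := indicator_of_notMem (show M ω ∉ Iic Z from hMZ) _
        rw [h1, h3]
        have := mul_nonneg hs0 hψ0
        linarith
    have hfM : Integrable (fun ω => f (M ω)) P := integrable_bdd_comp hM hfc.measurable hfb
    have hfM' : Integrable (fun ω => f (M' ω)) P := integrable_bdd_comp hM' hfc.measurable hfb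
    have hint := integral_mono_ae hfM' (hfM.add (hgX.add (hsind.add hpi))) hpt
    have e1 : ∫ ω, (f (M ω) + (g (M ω) * X ω
        + (s.indicator (1 : Ω → ℝ) ω * ψ ω + max (X ω - a / 2) 0))) ∂P
        = ∫ ω, f (M ω) ∂P + (∫ ω, g (M ω) * X ω ∂P + (∫ ω, s.indicator (1 : Ω → ℝ) ω * ψ ω ∂P
          + ∫ ω, max (X ω - a / 2) 0 ∂P)) := by
      rw [integral_add hfM, integral_add hgX, integral_add hsind hpi]
      · exact hsind.add hpi
      · exact hgX.add (hsind.add hpi)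
    have e2 : ∫ ω, g (M ω) * X ω ∂P = (∫ ω, g (M ω) ∂P) * ∫ ω, X ω ∂P :=
      hind'.integral_fun_mul_eq_mul_integral hgi.1 hX.1
    have e3 : ∫ ω, s.indicator (1 : Ω → ℝ) ω * ψ ω ∂P = (∫ ω, ψ ω ∂P) * P.real s := by
      have hi : ProbabilityTheory.IndepFun (fun ω => (Ioi (a / 2)).indicator (1 : ℝ → ℝ) (M ω)) ψ P :=
        hind.comp (φ := (Ioi (a / 2)).indicator (1 : ℝ → ℝ)) (ψ := fun x => |x| * min 1 (|x| / a))
          (measurable_one.indicator measurableSet_Ioi) (by fun_prop)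
      have e : s.indicator (1 : Ω → ℝ) = fun ω => (Ioi (a / 2)).indicator (1 : ℝ → ℝ) (M ω) := by
        ext ω; simp [indicator, s]
      rw [← integral_indicator_one hs, mul_comm, e]
      exact hi.integral_fun_mul_eq_mul_integral
        (((measurable_one.indicator measurableSet_Ioi).comp hM).aestronglyMeasurable) hψi.1
    have hst := hord f hfc hfm ⟨_, hfb⟩
    have h2aZ : MeasurableSet {ω | 2 * a < M ω ∧ M ω ≤ Z} :=
      (measurableSet_lt measurable_const hM).inter (measurableSet_le hM measurable_const)
    have hge : P.real {ω | 2 * a < M ω ∧ M ω ≤ Z} ≤ ∫ ω, g (M ω) ∂P := by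
      refine integral_le_one_mul_real h2aZ hgi fun ω => ?_
      refine indicator_le' (fun ω hω => ?_) (fun ω _ => hg0 _) ω
      rw [hg, indicator_of_mem (show M ω ∈ Iic Z from hω.2), rampSlope_of_ge ha hω.1.le]
      rfl
    have := mul_le_mul_of_nonneg_left hge hδ0.le
    have e4 : (∫ ω, g (M ω) ∂P) * ∫ ω, X ω ∂P = - (δ * ∫ ω, g (M ω) ∂P) := by rw [hδ]; ring
    simp only [Pi.add_apply] at hint
    linarith
  -- remove the truncation
  have hlim := ((tendsto_tail (P := P) hM).const_mul δ).const_add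
    ((∫ ω, max (X ω - a / 2) 0 ∂P) + (∫ ω, ψ ω ∂P) * P.real s)
  rw [mul_zero, add_zero] at hlim
  refine ge_of_tendsto hlim ?_
  filter_upwards [eventually_ge_atTop (2 * a)] with Z hZ
  have hsub : {ω | 2 * a < M ω} ⊆ {ω | 2 * a < M ω ∧ M ω ≤ Z} ∪ {ω | Z < M ω} := fun ω hω => by
    rcases le_or_gt (M ω) Z with h | h
    · exact Or.inl ⟨hω, h⟩
    · exact Or.inr h
  have h1 := (measureReal_mono (μ := P) hsub).trans (measureReal_union_le _ _)
  have h2 := mul_le_mul_of_nonneg_left h1 hδ0.le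
  have := key Z hZ
  linarith

/-- Lower tail estimate for a stationary `T` that is raised to at least `B` and then decreases by at
most `A`. -/
lemma drift_tail_ge {T T' A B : Ω → ℝ} (hT : Measurable T) (hT' : Measurable T')
    (hA : Integrable A P) (hB : Integrable B P) (hAm : Measurable A) (hBm : Measurable B)
    (hA0 : ∀ᵐ ω ∂P, 0 ≤ A ω) (hind : ProbabilityTheory.IndepFun T (fun ω => (A ω, B ω)) P)
    (hstep : ∀ᵐ ω ∂P, max (T ω) (B ω) - A ω ≤ T' ω) (hord : StochLE P T' T) (x : ℝ) :
    P.real {ω | T ω ≤ x} * ∫ ω, max (B ω - A ω - x) 0 ∂P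
      ≤ (∫ ω, A ω ∂P) * P.real {ω | x < T ω} := by
  set s : Set Ω := {ω | x < T ω}
  set s' : Set Ω := {ω | T ω ≤ x}
  have hs : MeasurableSet s := measurableSet_lt measurable_const hT
  have hs' : MeasurableSet s' := measurableSet_le hT measurable_const
  have hXi : Integrable (fun ω => max (B ω - A ω - x) 0) P :=
    ((hB.sub hA).sub (integrable_const _)).pos_part
  have key : ∀ n : ℕ, P.real s' * ∫ ω, min (max (B ω - A ω - x) 0) n ∂P
      ≤ (∫ ω, A ω ∂P) * P.real s := by
    intro n
    set g : ℝ → ℝ := fun t => min (max (t - x) 0) n with hg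
    have hgc : Continuous g := by rw [hg]; fun_prop
    have hgm : Monotone g := fun u v h => min_le_min (max_le_max (by linarith) le_rfl) le_rfl
    have hg0 : ∀ t, 0 ≤ g t := fun t => le_min (le_max_right _ _) n.cast_nonneg
    have hgb : ∀ t, |g t| ≤ n := fun t => by rw [abs_of_nonneg (hg0 t)]; exact min_le_right _ _
    have hgl : ∀ t u, 0 ≤ u → g t ≤ g (t - u) + u := fun t u hu => by
      rw [hg]
      simp only
      rw [← min_add_add_right, ← max_add_add_right]
      exact min_le_min (max_le_max (by linarith) (by linarith)) (by linarith)
    set Y : Ω → ℝ := fun ω => g (B ω - A ω) with hY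
    have hYi : Integrable Y P := integrable_bdd_comp (hBm.sub hAm) hgc.measurable hgb
    have hgT : Integrable (fun ω => g (T ω)) P := integrable_bdd_comp hT hgc.measurable hgb
    have hgT' : Integrable (fun ω => g (T' ω)) P := integrable_bdd_comp hT' hgc.measurable hgb
    have i1 : Integrable (fun ω => s'.indicator (1 : Ω → ℝ) ω * Y ω) P := by
      have : (fun ω => s'.indicator (1 : Ω → ℝ) ω * Y ω) = s'.indicator Y := by
        ext ω; by_cases h : ω ∈ s' <;> simp [h]
      rw [this]; exact hYi.indicator hs'
    have i2 : Integrable (fun ω => s.indicator (1 : Ω → ℝ) ω * A ω) P := by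
      have : (fun ω => s.indicator (1 : Ω → ℝ) ω * A ω) = s.indicator A := by
        ext ω; by_cases h : ω ∈ s <;> simp [h]
      rw [this]; exact hA.indicator hs
    have hpt : ∀ᵐ ω ∂P, g (T ω) + s'.indicator (1 : Ω → ℝ) ω * Y ω
        ≤ g (T' ω) + s.indicator (1 : Ω → ℝ) ω * A ω := by
      filter_upwards [hstep, hA0] with ω hω hAω
      rcases le_or_gt (T ω) x with h | h
      · rw [indicator_of_mem (show ω ∈ s' from h),
          indicator_of_notMem (show ω ∉ s from not_lt.2 h)]
        have h1 : g (T ω) = 0 := by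
          simp only [hg]
          rw [max_eq_right (by linarith), min_eq_left n.cast_nonneg]
        have h2 : Y ω ≤ g (T' ω) := hgm (le_trans (by linarith [le_max_right (T ω) (B ω)]) hω)
        simp only [Pi.one_apply]
        linarith
      · rw [indicator_of_mem (show ω ∈ s from h),
          indicator_of_notMem (show ω ∉ s' from not_le.2 h)]
        have h2 : g (T ω - A ω) ≤ g (T' ω) :=
          hgm (le_trans (by linarith [le_max_left (T ω) (B ω)]) hω)
        have h3 := hgl (T ω) (A ω) hAω
        simp only [Pi.one_apply]
        linarith
    have hint := integral_mono_ae (hgT.add i1) (hgT'.add i2) hpt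
    simp only [Pi.add_apply] at hint
    rw [integral_add hgT i1, integral_add hgT' i2] at hint
    have e1 : ∫ ω, s'.indicator (1 : Ω → ℝ) ω * Y ω ∂P = P.real s' * ∫ ω, Y ω ∂P := by
      have hi : ProbabilityTheory.IndepFun (fun ω => (Iic x).indicator (1 : ℝ → ℝ) (T ω)) Y P :=
        hind.comp (φ := (Iic x).indicator (1 : ℝ → ℝ)) (ψ := fun p : ℝ × ℝ => g (p.2 - p.1))
          (measurable_one.indicator measurableSet_Iic)
          (hgc.comp (continuous_snd.sub continuous_fst)).measurable
      have e : s'.indicator (1 : Ω → ℝ) = fun ω => (Iic x).indicator (1 : ℝ → ℝ) (T ω) := by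
        ext ω; simp [indicator, s']
      rw [← integral_indicator_one hs', e]
      exact hi.integral_fun_mul_eq_mul_integral
        (((measurable_one.indicator measurableSet_Iic).comp hT).aestronglyMeasurable) hYi.1
    have e2 : ∫ ω, s.indicator (1 : Ω → ℝ) ω * A ω ∂P = (∫ ω, A ω ∂P) * P.real s := by
      have hi : ProbabilityTheory.IndepFun (fun ω => (Ioi x).indicator (1 : ℝ → ℝ) (T ω)) A P :=
        hind.comp (φ := (Ioi x).indicator (1 : ℝ → ℝ)) (ψ := Prod.fst)
          (measurable_one.indicator measurableSet_Ioi) measurable_fst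
      have e : s.indicator (1 : Ω → ℝ) = fun ω => (Ioi x).indicator (1 : ℝ → ℝ) (T ω) := by
        ext ω; simp [indicator, s]
      rw [← integral_indicator_one hs, mul_comm, e]
      exact hi.integral_fun_mul_eq_mul_integral
        (((measurable_one.indicator measurableSet_Ioi).comp hT).aestronglyMeasurable) hA.1
    have hst := hord g hgc hgm ⟨_, hgb⟩
    have e3 : ∫ ω, Y ω ∂P = ∫ ω, min (max (B ω - A ω - x) 0) (n : ℝ) ∂P := rfl
    rw [← e3]
    linarith
  have hlim : Tendsto (fun n : ℕ => ∫ ω, min (max (B ω - A ω - x) 0) (n : ℝ) ∂P) atTop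
      (nhds (∫ ω, max (B ω - A ω - x) 0 ∂P)) := by
    refine tendsto_integral_of_dominated_convergence _ (fun n => ?_) hXi (fun n => ?_) ?_
    · exact Measurable.aestronglyMeasurable (by fun_prop)
    · refine ae_of_all _ fun ω => ?_
      rw [Real.norm_eq_abs, abs_of_nonneg (le_min (le_max_right _ _) n.cast_nonneg)]
      exact min_le_left _ _
    · refine ae_of_all _ fun ω => ?_
      refine tendsto_const_nhds.congr' ?_
      filter_upwards [eventually_ge_atTop ⌈max (B ω - A ω - x) 0⌉₊] with n hn
      exact (min_eq_left (Nat.ceil_le.1 hn)).symm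
  exact le_of_tendsto (hlim.const_mul _) (Eventually.of_forall key)

end drift

/-- A tail that is bounded at `x` by `H (x / 4)` plus a vanishing fraction of itself at `x / 4` is
of the order of `H`. -/
lemma tail_le_of_recursion {G H e : ℝ → ℝ} {D : ℝ} (hG : ∀ x, G x ≤ 1) (hH : ∀ x, 0 < H x)
    (hHa : Antitone H) (he0 : ∀ x, 0 ≤ e x) (he : Tendsto e atTop (nhds 0)) (hD : 0 < D)
    (hdbl : ∀ᶠ x in atTop, H (x / 4) ≤ D * H x)
    (hrec : ∀ᶠ x in atTop, G x ≤ D * H (x / 4) + e x * G (x / 4)) :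
    ∃ C, 0 < C ∧ ∀ᶠ x in atTop, G x ≤ C * H x := by
  have he' : ∀ᶠ x in atTop, e x ≤ 1 / (2 * D) :=
    he.eventually (Iic_mem_nhds (by positivity))
  obtain ⟨x₁, hx₁⟩ := (hdbl.and (hrec.and (he'.and (eventually_gt_atTop 0)))).exists_forall_of_atTop
  have hpos : 0 < x₁ := (hx₁ x₁ le_rfl).2.2.2
  set C := max (2 * (D * D)) (1 / H x₁) with hC
  have hC0 : 0 < C := lt_max_of_lt_left (by positivity)
  have hC1 : 1 ≤ C * H x₁ := by
    have := mul_le_mul_of_nonneg_right (le_max_right (2 * (D * D)) (1 / H x₁)) (hH x₁).le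
    rwa [one_div_mul_cancel (hH x₁).ne'] at this
  have claim : ∀ n : ℕ, ∀ x, x ≤ 4 ^ n * x₁ → G x ≤ C * H x := by
    intro n
    induction n with
    | zero =>
      intro x hx
      rw [pow_zero, one_mul] at hx
      exact (hG x).trans (hC1.trans (mul_le_mul_of_nonneg_left (hHa hx) hC0.le))
    | succ n ih =>
      intro x hx
      rcases le_total x x₁ with h | h
      · exact (hG x).trans (hC1.trans (mul_le_mul_of_nonneg_left (hHa h) hC0.le))
      obtain ⟨h1, h2, h3, -⟩ := hx₁ x h
      have h4 := ih (x / 4) (by rw [pow_succ] at hx; linarith)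
      have h5 : e x * G (x / 4) ≤ 1 / (2 * D) * (C * (D * H x)) := by
        have ha : e x * G (x / 4) ≤ e x * (C * (D * H x)) :=
          mul_le_mul_of_nonneg_left (h4.trans (mul_le_mul_of_nonneg_left h1 hC0.le)) (he0 x)
        have hb : 0 ≤ C * (D * H x) := by have := hH x; positivity
        exact ha.trans (mul_le_mul_of_nonneg_right h3 hb)
      have h6 : 1 / (2 * D) * (C * (D * H x)) = C / 2 * H x := by field_simp
      have h7 : D * H (x / 4) ≤ C / 2 * H x := by
        have ha := mul_le_mul_of_nonneg_left h1 hD.le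
        have hb := mul_le_mul_of_nonneg_right (le_max_left (2 * (D * D)) (1 / H x₁)) (hH x).le
        rw [← hC] at hb
        linarith
      linarith
  refine ⟨C, hC0, Eventually.of_forall fun x => ?_⟩
  obtain ⟨n, hn⟩ := pow_unbounded_of_one_lt (x / x₁) (by norm_num : (1 : ℝ) < 4)
  exact claim n x ((div_le_iff₀ hpos).1 hn.le)

section jobLaw

variable {N nF : ℕ} (nJ : ℕ) (lawA : Measure ℝ) [IsProbabilityMeasure lawA]
  (lawB : Measure (Fin nF → ℝ)) [IsProbabilityMeasure lawB]

lemma isProbabilityMeasure_serverLaw (hFN : nF ≤ N) : IsProbabilityMeasure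
    (ProbabilityTheory.uniformOn {s : Fin nF → Fin N | Function.Injective s}) :=
  ProbabilityTheory.isProbabilityMeasure_uniformOn (toFinite _)
    ⟨Fin.castLE hFN, Fin.castLE_injective hFN⟩

lemma isProbabilityMeasure_jobLaw (hFN : nF ≤ N) : IsProbabilityMeasure (jobLaw N lawA lawB) := by
  have := isProbabilityMeasure_serverLaw hFN
  unfold jobLaw
  infer_instance

lemma measurePreserving_sizes_time (hFN : nF ≤ N) :
    MeasurePreserving (fun j : (Fin nF → Fin N) × (Fin nF → ℝ) × ℝ => j.2)
      (jobLaw N lawA lawB) (lawB.prod lawA) := by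
  have := isProbabilityMeasure_serverLaw hFN
  exact measurePreserving_snd

lemma measurePreserving_sizes (hFN : nF ≤ N) :
    MeasurePreserving (fun j : (Fin nF → Fin N) × (Fin nF → ℝ) × ℝ => j.2.1)
      (jobLaw N lawA lawB) lawB :=
  measurePreserving_fst.comp (measurePreserving_sizes_time lawA lawB hFN)

lemma measurePreserving_time (hFN : nF ≤ N) :
    MeasurePreserving (fun j : (Fin nF → Fin N) × (Fin nF → ℝ) × ℝ => j.2.2)
      (jobLaw N lawA lawB) lawA :=
  measurePreserving_snd.comp (measurePreserving_sizes_time lawA lawB hFN)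

lemma ae_injective_servers (hFN : nF ≤ N) :
    ∀ᵐ j ∂jobLaw N lawA lawB, Function.Injective j.1 := by
  have := isProbabilityMeasure_serverLaw hFN
  have h : ∀ᵐ s ∂ProbabilityTheory.uniformOn {s : Fin nF → Fin N | Function.Injective s},
      Function.Injective s := by
    have h1 := ProbabilityTheory.uniformOn_self
      (toFinite {s : Fin nF → Fin N | Function.Injective s})
      ⟨Fin.castLE hFN, Fin.castLE_injective hFN⟩
    exact (prob_compl_eq_zero_iff (toFinite _).measurableSet).2 h1
  exact (measurePreserving_fst (μ := ProbabilityTheory.uniformOn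
    {s : Fin nF → Fin N | Function.Injective s}) (ν := lawB.prod lawA)).quasiMeasurePreserving.ae h

variable {lawA lawB nJ}

lemma measurable_orderStat {n : ℕ} (k : ℕ) : Measurable (orderStat k : (Fin n → ℝ) → ℝ) :=
  (continuous_orderStat k).measurable

lemma measurable_maxLoad {N : ℕ} : Measurable (maxLoad : (Fin N → ℝ) → ℝ) :=
  measurable_orderStat N

lemma measurable_topLoad {N : ℕ} : Measurable (topLoad nF nJ : (Fin N → ℝ) → ℝ) :=
  measurable_orderStat _

lemma ae_sizes_nonneg (hFN : nF ≤ N) (hB : ∀ᵐ b ∂lawB, ∀ l, 0 ≤ b l) :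
    ∀ᵐ j ∂jobLaw N lawA lawB, ∀ l, 0 ≤ j.2.1 l :=
  (measurePreserving_sizes lawA lawB hFN).quasiMeasurePreserving.ae hB

lemma ae_time_nonneg (hFN : nF ≤ N) (hA : ∀ᵐ a ∂lawA, 0 ≤ a) :
    ∀ᵐ j ∂jobLaw N lawA lawB, 0 ≤ j.2.2 :=
  (measurePreserving_time lawA lawB hFN).quasiMeasurePreserving.ae hA

lemma integrable_increment (hFN : nF ≤ N) (hA : Integrable (fun a => a) lawA)
    (hB : Integrable (fun b => orderStat nJ b) lawB) :
    Integrable (fun j => orderStat nJ j.2.1 - j.2.2) (jobLaw N lawA lawB) :=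
  ((measurePreserving_sizes lawA lawB hFN).integrable_comp_of_integrable hB).sub
    ((measurePreserving_time lawA lawB hFN).integrable_comp_of_integrable hA)

lemma MeasurePreserving.integral_comp_of_measurable {α β : Type*} [MeasurableSpace α]
    [MeasurableSpace β] {μ : Measure α} {ν : Measure β} {f : α → β} (hf : MeasurePreserving f μ ν)
    {g : β → ℝ} (hg : Measurable g) : ∫ x, g (f x) ∂μ = ∫ y, g y ∂ν := by
  rw [← hf.map_eq, integral_map hf.measurable.aemeasurable hg.aestronglyMeasurable]

lemma integral_increment (hFN : nF ≤ N) (hA : Integrable (fun a => a) lawA)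
    (hB : Integrable (fun b => orderStat nJ b) lawB) :
    ∫ j, (orderStat nJ j.2.1 - j.2.2) ∂jobLaw N lawA lawB
      = (∫ b, orderStat nJ b ∂lawB) - ∫ a, a ∂lawA := by
  have hB' : Integrable (fun j => orderStat nJ j.2.1) (jobLaw N lawA lawB) :=
    (measurePreserving_sizes lawA lawB hFN).integrable_comp_of_integrable hB
  have hA' : Integrable (fun j => j.2.2) (jobLaw N lawA lawB) :=
    (measurePreserving_time lawA lawB hFN).integrable_comp_of_integrable hA
  rw [integral_sub hB' hA',
    MeasurePreserving.integral_comp_of_measurable (measurePreserving_sizes lawA lawB hFN)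
      (measurable_orderStat nJ),
    MeasurePreserving.integral_comp_of_measurable (measurePreserving_time lawA lawB hFN)
      measurable_id']

/-- Tail estimate for workloads whose maximum does not decrease stochastically in one step. -/
lemma maxLoad_tail_le (hJ : 1 ≤ nJ) (hJF : nJ ≤ nF) (hFN : nF ≤ N)
    (hA : Integrable (fun a => a) lawA) (hB : Integrable (fun b => orderStat nJ b) lawB)
    (hB0 : ∀ᵐ b ∂lawB, ∀ l, 0 ≤ b l)
    {Ω : Type*} [MeasurableSpace Ω] {P : Measure Ω} [IsProbabilityMeasure P]
    {V : Ω → Fin N → ℝ} (hV : Measurable V)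
    (hord : StochLE (P.prod (jobLaw N lawA lawB)) (fun p => maxLoad (V p.1))
      (fun p => maxLoad (nextWorkload nJ (V p.1) p.2.1 p.2.2.1 p.2.2.2))) {a : ℝ} (ha : 0 < a) :
    ((∫ a, a ∂lawA) - ∫ b, orderStat nJ b ∂lawB) * P.real {ω | 2 * a < maxLoad (V ω)} ≤
      (∫ j, max (orderStat nJ j.2.1 - j.2.2 - a / 2) 0 ∂jobLaw N lawA lawB)
        + (∫ j, |orderStat nJ j.2.1 - j.2.2| * min 1 (|orderStat nJ j.2.1 - j.2.2| / a)
            ∂jobLaw N lawA lawB) * P.real {ω | a / 2 < maxLoad (V ω)} := by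
  have hκ := isProbabilityMeasure_jobLaw lawA lawB hFN
  set κ := jobLaw N lawA lawB
  have h2 : MeasurePreserving Prod.snd (P.prod κ) κ := measurePreserving_snd
  have h1 : MeasurePreserving Prod.fst (P.prod κ) P := measurePreserving_fst
  have hm : Measurable fun j : (Fin nF → Fin N) × (Fin nF → ℝ) × ℝ =>
      orderStat nJ j.2.1 - j.2.2 :=
    ((measurable_orderStat nJ).comp (measurable_fst.comp measurable_snd)).sub
      (measurable_snd.comp measurable_snd)
  have hVM : Measurable fun ω => maxLoad (V ω) := measurable_maxLoad.comp hV
  have key := drift_tail_le (P := P.prod κ) (M := fun p => maxLoad (V p.1))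
    (M' := fun p => maxLoad (nextWorkload nJ (V p.1) p.2.1 p.2.2.1 p.2.2.2))
    (X := fun p => orderStat nJ p.2.2.1 - p.2.2.2)
    (hVM.comp measurable_fst)
    (measurable_maxLoad.comp (measurable_nextWorkload.comp
      ((hV.comp measurable_fst).prodMk measurable_snd)))
    (hm.comp measurable_snd)
    (h2.integrable_comp_of_integrable (integrable_increment hFN hA hB))
    (ProbabilityTheory.indepFun_prod hVM hm)
    ((h2.quasiMeasurePreserving.ae (ae_sizes_nonneg hFN hB0)).mono fun p hp =>
      maxLoad_nextWorkload_le (by omega) hJ hJF _ _ hp _)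
    hord ha
  rw [MeasurePreserving.integral_comp_of_measurable h2 hm, integral_increment hFN hA hB,
    neg_sub, MeasurePreserving.integral_comp_of_measurable h2
      (g := fun j => max (orderStat nJ j.2.1 - j.2.2 - a / 2) 0) (by fun_prop),
    MeasurePreserving.integral_comp_of_measurable h2
      (g := fun j => |orderStat nJ j.2.1 - j.2.2| * min 1 (|orderStat nJ j.2.1 - j.2.2| / a))
      (by fun_prop)] at key
  have e : ∀ t : ℝ, (P.prod κ).real {p | t < maxLoad (V p.1)} = P.real {ω | t < maxLoad (V ω)} :=
    fun t => h1.measureReal_preimage (measurableSet_lt measurable_const hVM).nullMeasurableSet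
  rwa [e, e] at key

end jobLaw

section loynes

/-- Prepending an independent term to an i.i.d. sequence. -/
lemma measurePreserving_shift {J : Type*} [MeasurableSpace J] (κ : Measure J)
    [IsProbabilityMeasure κ] :
    MeasurePreserving (fun ω : ℕ → J => ((fun k => ω (k + 1)), ω 0))
      (Measure.infinitePi fun _ => κ) ((Measure.infinitePi fun _ => κ).prod κ) := by
  set P := Measure.infinitePi fun _ : ℕ => κ
  set c : (ℕ → J) × J → ℕ → J := fun p k => Nat.casesOn k p.2 p.1
  have hc : Measurable c := by
    refine measurable_pi_lambda _ fun k => ?_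
    cases k with
    | zero => exact measurable_snd
    | succ k => exact (measurable_pi_apply k).comp measurable_fst
  have hS : Measurable fun ω : ℕ → J => ((fun k => ω (k + 1)), ω 0) := by fun_prop
  have h : (P.prod κ).map c = P := by
    refine Measure.eq_infinitePi _ fun s t ht => ?_
    classical
    set t' : ℕ → Set J := fun i => if i ∈ s then t i else univ
    obtain ⟨n, hn⟩ : ∃ n, s ⊆ Finset.range (n + 1) :=
      ⟨s.sup id, fun i hi => Finset.mem_range.2 (Nat.lt_succ_of_le (Finset.le_sup (f := id) hi))⟩
    have ht' : ∀ i, MeasurableSet (t' i) := fun i => by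
      by_cases hi : i ∈ s <;> simp [t', hi, ht]
    have e0 : (s : Set ℕ).pi t = (Finset.range (n + 1) : Set ℕ).pi t' := by
      ext ω
      simp only [Set.mem_pi, Finset.mem_coe, t']
      constructor
      · intro h i _
        by_cases hi : i ∈ s
        · simpa [hi] using h i hi
        · simp [hi]
      · intro h i hi
        simpa [hi] using h i (hn hi)
    have e1 : ∏ i ∈ s, κ (t i) = ∏ i ∈ Finset.range (n + 1), κ (t' i) := by
      rw [← Finset.prod_subset hn]
      · exact Finset.prod_congr rfl fun i hi => by simp [t', hi]
      · intro i _ hi; simp [t', hi]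
    have e2 : c ⁻¹' ((Finset.range (n + 1) : Set ℕ).pi t')
        = ((Finset.range n : Set ℕ).pi fun i => t' (i + 1)) ×ˢ t' 0 := by
      ext p
      simp only [mem_preimage, Set.mem_pi, Finset.coe_range, mem_Iio, mem_prod]
      constructor
      · intro h
        exact ⟨fun i hi => h (i + 1) (by omega), h 0 (by omega)⟩
      · rintro ⟨h1, h0⟩ i hi
        cases i with
        | zero => exact h0
        | succ i => exact h1 i (by omega)
    rw [e0, e1, Measure.map_apply hc
      (MeasurableSet.pi (Finset.range (n + 1)).countable_toSet fun i _ => ht' i), e2,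
      Measure.prod_prod, Measure.infinitePi_pi _ (fun i _ => ht' _), Finset.prod_range_succ']
  refine ⟨hS, ?_⟩
  conv_lhs => rw [← h]
  rw [Measure.map_map hS hc]
  exact Measure.map_id

variable {N nF : ℕ} (nJ : ℕ)

/-- The workloads found by the job `0` if the system is empty when the job `n` arrives; the jobs are
numbered backwards in time. -/
noncomputable def backwardLoad : ℕ → (ℕ → (Fin nF → Fin N) × (Fin nF → ℝ) × ℝ) → Fin N → ℝ
  | 0, _ => 0
  | n + 1, ω => nextWorkload nJ (backwardLoad n fun k => ω (k + 1)) (ω 0).1 (ω 0).2.1 (ω 0).2.2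

lemma measurable_backwardLoad (n : ℕ) :
    Measurable (backwardLoad nJ n : (ℕ → (Fin nF → Fin N) × (Fin nF → ℝ) × ℝ) → Fin N → ℝ) := by
  induction n with
  | zero => exact measurable_const
  | succ n ih =>
    exact measurable_nextWorkload.comp ((ih.comp (by fun_prop)).prodMk (measurable_pi_apply 0))

lemma backwardLoad_mono (ω : ℕ → (Fin nF → Fin N) × (Fin nF → ℝ) × ℝ) :
    Monotone fun n => backwardLoad nJ n ω := by
  refine monotone_nat_of_le_succ fun n => ?_
  induction n generalizing ω with
  | zero => exact fun i => nextWorkload_nonneg _ _ _ _ i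
  | succ n ih => exact nextWorkload_mono _ _ _ (ih fun k => ω (k + 1))

variable {nJ} {lawA : Measure ℝ} [IsProbabilityMeasure lawA]
  {lawB : Measure (Fin nF → ℝ)} [IsProbabilityMeasure lawB]

lemma maxLoad_mono {N : ℕ} : Monotone (maxLoad : (Fin N → ℝ) → ℝ) := orderStat_mono N

lemma ae_bddAbove_backwardLoad (hJ : 1 ≤ nJ) (hJF : nJ ≤ nF) (hFN : nF ≤ N)
    (hA : Integrable (fun a => a) lawA) (hB : Integrable (fun b => orderStat nJ b) lawB)
    (hB0 : ∀ᵐ b ∂lawB, ∀ l, 0 ≤ b l)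
    (hstab : (∫ b, orderStat nJ b ∂lawB) < ∫ a, a ∂lawA) :
    ∀ᵐ ω ∂Measure.infinitePi fun _ : ℕ => jobLaw N lawA lawB,
      ∀ i, BddAbove (range fun n => backwardLoad nJ n ω i) := by
  have hκ := isProbabilityMeasure_jobLaw lawA lawB hFN
  set κ := jobLaw N lawA lawB
  set P := Measure.infinitePi fun _ : ℕ => κ
  set δ := (∫ a, a ∂lawA) - ∫ b, orderStat nJ b ∂lawB with hδ
  have hδ0 : 0 < δ := sub_pos.2 hstab
  have hX := integrable_increment (N := N) hFN hA hB
  set ε : ℝ → ℝ := fun a => ((∫ j, max (orderStat nJ j.2.1 - j.2.2 - a / 2) 0 ∂κ)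
    + ∫ j, |orderStat nJ j.2.1 - j.2.2| * min 1 (|orderStat nJ j.2.1 - j.2.2| / a) ∂κ) / δ
  have hε : Tendsto ε atTop (nhds 0) := by
    have h1 := ((tendsto_integral_excess hX).comp (tendsto_id.atTop_div_const two_pos)).add
      (tendsto_integral_mul_min hX)
    simpa using h1.div_const δ
  have hbd : ∀ n, ∀ a : ℝ, 0 < a → P.real {ω | 2 * a < maxLoad (backwardLoad nJ n ω)} ≤ ε a := by
    intro n a ha
    have hord : StochLE (P.prod κ) (fun p => maxLoad (backwardLoad nJ n p.1))
        (fun p => maxLoad (nextWorkload nJ (backwardLoad nJ n p.1) p.2.1 p.2.2.1 p.2.2.2)) := by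
      intro g hgc hgm ⟨C, hC⟩
      have hV := measurable_backwardLoad (N := N) (nF := nF) nJ
      have h1 : ∫ p, g (maxLoad (backwardLoad nJ n p.1)) ∂(P.prod κ)
          = ∫ ω, g (maxLoad (backwardLoad nJ n ω)) ∂P :=
        MeasurePreserving.integral_comp_of_measurable measurePreserving_fst
          (g := fun ω => g (maxLoad (backwardLoad nJ n ω)))
          (hgc.measurable.comp (measurable_maxLoad.comp (hV n)))
      have h2 : ∫ ω, g (maxLoad (backwardLoad nJ (n + 1) ω)) ∂P = ∫ p, g (maxLoad
          (nextWorkload nJ (backwardLoad nJ n p.1) p.2.1 p.2.2.1 p.2.2.2)) ∂(P.prod κ) :=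
        MeasurePreserving.integral_comp_of_measurable (measurePreserving_shift κ)
          (g := fun p => g (maxLoad
            (nextWorkload nJ (backwardLoad nJ n p.1) p.2.1 p.2.2.1 p.2.2.2)))
          (hgc.measurable.comp (measurable_maxLoad.comp (measurable_nextWorkload.comp
            (((hV n).comp measurable_fst).prodMk measurable_snd))))
      rw [h1, ← h2]
      refine integral_mono (integrable_bdd_comp (measurable_maxLoad.comp (hV n)) hgc.measurable hC)
        (integrable_bdd_comp (measurable_maxLoad.comp (hV (n + 1))) hgc.measurable hC) fun ω => ?_
      exact hgm (maxLoad_mono (backwardLoad_mono nJ ω n.le_succ))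
    have h := maxLoad_tail_le hJ hJF hFN hA hB hB0 (measurable_backwardLoad nJ n) hord ha
    rw [le_div_iff₀ hδ0, mul_comm]
    refine h.trans (add_le_add le_rfl (mul_le_of_le_one_right ?_ measureReal_le_one))
    exact integral_nonneg fun j => by positivity
  set bad : Set (ℕ → (Fin nF → Fin N) × (Fin nF → ℝ) × ℝ) :=
    {ω | ∃ i, ¬ BddAbove (range fun n => backwardLoad nJ n ω i)}
  have hnull : ∀ a : ℝ, 0 < a → P bad
      ≤ ENNReal.ofReal (ε a) := by
    intro a ha
    have hsub : bad ⊆ ⋃ n, {ω | 2 * a < maxLoad (backwardLoad nJ n ω)} := by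
      rintro ω ⟨i, hi⟩
      by_contra hω
      simp only [mem_iUnion, mem_ofPred_eq, not_exists, not_lt] at hω
      refine hi ⟨2 * a, ?_⟩
      rintro _ ⟨n, rfl⟩
      exact (le_maxLoad _ i).trans (hω n)
    have hmono : Monotone fun n => {ω : ℕ → (Fin nF → Fin N) × (Fin nF → ℝ) × ℝ |
        2 * a < maxLoad (backwardLoad nJ n ω)} :=
      fun m n hmn ω hω => lt_of_lt_of_le hω (maxLoad_mono (backwardLoad_mono nJ ω hmn))
    refine (measure_mono hsub).trans ?_
    rw [hmono.measure_iUnion]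
    refine iSup_le fun n => ?_
    rw [← ofReal_measureReal]
    exact ENNReal.ofReal_le_ofReal (hbd n a ha)
  have h0 : P bad ≤ 0 := by
    have h1 := ENNReal.tendsto_ofReal hε
    rw [ENNReal.ofReal_zero] at h1
    exact ge_of_tendsto h1 ((eventually_gt_atTop 0).mono hnull)
  have h1 : ∀ᵐ ω ∂P, ¬ ∃ i, ¬ BddAbove (range fun n => backwardLoad nJ n ω i) := by
    rw [ae_iff]
    simpa only [not_not] using le_antisymm h0 bot_le
  exact h1.mono fun ω hω i => by
    by_contra h
    exact hω ⟨i, h⟩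

/-- Existence of a steady state, by Loynes' construction. -/
theorem exists_isSteadyState (hJ : 1 ≤ nJ) (hJF : nJ ≤ nF) (hFN : nF ≤ N)
    (hA : Integrable (fun a => a) lawA) (hB : Integrable (fun b => orderStat nJ b) lawB)
    (hB0 : ∀ᵐ b ∂lawB, ∀ l, 0 ≤ b l)
    (hstab : (∫ b, orderStat nJ b ∂lawB) < ∫ a, a ∂lawA) :
    ∃ π : Measure (Fin N → ℝ), IsSteadyState nJ lawA lawB π := by
  have hbdd := ae_bddAbove_backwardLoad hJ hJF hFN hA hB hB0 hstab
  have hκ := isProbabilityMeasure_jobLaw lawA lawB hFN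
  unfold IsSteadyState
  set κ := jobLaw N lawA lawB
  set P := Measure.infinitePi fun _ : ℕ => κ
  set V : (ℕ → (Fin nF → Fin N) × (Fin nF → ℝ) × ℝ) → Fin N → ℝ :=
    fun ω i => ⨆ n, backwardLoad nJ n ω i with hVdef
  have hV : Measurable V := measurable_pi_lambda _ fun i =>
    Measurable.iSup fun n => (measurable_pi_apply i).comp (measurable_backwardLoad nJ n)
  have hlim : ∀ ω, (∀ i, BddAbove (range fun n => backwardLoad nJ n ω i)) →
      Tendsto (fun n => backwardLoad nJ n ω) atTop (nhds (V ω)) := fun ω hω =>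
    tendsto_pi_nhds.2 fun i =>
      tendsto_atTop_ciSup (fun m n hmn => backwardLoad_mono nJ ω hmn i) (hω i)
  have hshift := measurePreserving_shift κ
  have hbdd' : ∀ᵐ ω ∂P, ∀ i, BddAbove (range fun n => backwardLoad nJ n (fun k => ω (k + 1)) i) :=
    (measurePreserving_fst.comp hshift).quasiMeasurePreserving.ae hbdd
  have hfix : ∀ᵐ ω ∂P, nextWorkload nJ (V fun k => ω (k + 1)) (ω 0).1 (ω 0).2.1 (ω 0).2.2 = V ω := by
    filter_upwards [hbdd, hbdd'] with ω h h'
    have h1 := (hlim ω h).comp (tendsto_add_atTop_nat 1)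
    have hc : Continuous fun v : Fin N → ℝ => nextWorkload nJ v (ω 0).1 (ω 0).2.1 (ω 0).2.2 :=
      (continuous_nextWorkload (ω 0).1).comp
        (by fun_prop : Continuous fun v : Fin N → ℝ => (v, (ω 0).2.1, (ω 0).2.2))
    exact tendsto_nhds_unique ((hc.tendsto _).comp (hlim _ h')) h1
  refine ⟨P.map V, Measure.isProbabilityMeasure_map hV.aemeasurable, ?_⟩
  have hprod : (P.map V).prod κ = (P.prod κ).map (Prod.map V id) := by
    conv_lhs => rw [← Measure.map_id (μ := κ)]
    exact Measure.map_prod_map P κ hV measurable_id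
  rw [hprod, Measure.map_map measurable_nextWorkload (hV.prodMap measurable_id), ← hshift.map_eq,
    Measure.map_map (measurable_nextWorkload.comp (hV.prodMap measurable_id)) hshift.measurable]
  exact Measure.map_congr hfix

end loynes

section regularVariation

variable {β : Measure ℝ} {r : ℝ}

lemma IsRV.tendsto_ratio (h : IsRV β r) {c : ℝ} (hc : 0 < c) :
    Tendsto (fun x => β.real (Ioi (c * x)) / β.real (Ioi x)) atTop (nhds (c ^ r)) := by
  obtain ⟨L, hL, hLx⟩ := h
  have h1 := (hL c hc).mul_const (c ^ r)
  rw [one_mul] at h1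
  refine h1.congr' ?_
  filter_upwards [eventually_gt_atTop 0] with x hx
  rw [hLx x hx, hLx (c * x) (mul_pos hc hx), Real.mul_rpow hc.le hx.le]
  have := (Real.rpow_pos_of_pos hx r).ne'
  rw [← mul_assoc, mul_div_mul_right _ _ this, mul_div_right_comm]

variable [IsProbabilityMeasure β]

lemma IsRV.tail_pos (h : IsRV β r) (x : ℝ) : 0 < β.real (Ioi x) := by
  obtain ⟨y, hxy, hy⟩ := (((h.tendsto_ratio two_pos).eventually_ne
    (Real.rpow_pos_of_pos two_pos r).ne').and (eventually_ge_atTop x)).exists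
  have h1 : β.real (Ioi y) ≠ 0 := fun h0 => hxy (by rw [h0, div_zero])
  exact (lt_of_le_of_ne measureReal_nonneg h1.symm).trans_le (measureReal_mono (Ioi_subset_Ioi hy))

lemma isRV_of_tendsto_ratio {μ : Measure ℝ}
    (h : ∀ c : ℝ, 0 < c → Tendsto (fun x => μ.real (Ioi (c * x)) / μ.real (Ioi x)) atTop
      (nhds (c ^ r))) : IsRV μ r := by
  refine ⟨fun x => μ.real (Ioi x) * x ^ (-r), fun c hc => ?_, fun x hx => ?_⟩
  · have h1 := (h c hc).mul_const (c ^ (-r))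
    rw [← Real.rpow_add hc, add_neg_cancel, Real.rpow_zero] at h1
    refine h1.congr' ?_
    filter_upwards [eventually_gt_atTop 0] with x hx
    have := (Real.rpow_pos_of_pos hx (-r)).ne'
    rw [Real.mul_rpow hc.le hx.le, ← mul_assoc, mul_div_mul_right _ _ this, mul_div_right_comm]
  · rw [mul_assoc, ← Real.rpow_add hx, neg_add_cancel, Real.rpow_zero, mul_one]

/-- The integrated tail `E (B - x)⁺` of the law `β` of `B`. -/
noncomputable def excess (β : Measure ℝ) (x : ℝ) : ℝ := ∫ b, max (b - x) 0 ∂β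

lemma integrable_excess (hβ : Integrable (fun b => b) β) (x : ℝ) :
    Integrable (fun b => max (b - x) 0) β :=
  (hβ.sub (integrable_const x)).pos_part

lemma excess_antitone (hβ : Integrable (fun b => b) β) : Antitone (excess β) := fun x y hxy =>
  integral_mono (integrable_excess hβ y) (integrable_excess hβ x) fun b =>
    max_le_max (by linarith) le_rfl

lemma excess_pos (hβ : Integrable (fun b => b) β) {x : ℝ} (h : 0 < β.real (Ioi x)) :
    0 < excess β x := by
  rw [excess, integral_pos_iff_support_of_nonneg (f := fun b => max (b - x) 0)
    (fun b => le_max_right _ _) (integrable_excess hβ x)]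
  have e : Function.support (fun b : ℝ => max (b - x) 0) = Ioi x := by
    ext b
    simp only [Function.mem_support, ne_eq, max_eq_right_iff, not_le, mem_Ioi, sub_pos]
  rw [e]
  exact (ENNReal.toReal_pos_iff.1 h).1

lemma tail_mul_le_excess (hβ : Integrable (fun b => b) β) (x y : ℝ) :
    (y - x) * β.real (Ioi y) ≤ excess β x := by
  have h : ∫ b, (Ioi y).indicator (fun _ => y - x) b ∂β ≤ excess β x := by
    refine integral_mono ((integrable_const _).indicator measurableSet_Ioi)
      (integrable_excess hβ x) fun b => ?_
    by_cases hb : b ∈ Ioi y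
    · rw [indicator_of_mem hb]
      exact le_max_of_le_left (sub_le_sub_right (le_of_lt hb) x)
    · rw [indicator_of_notMem hb]
      exact le_max_right _ _
  rwa [integral_indicator_const _ measurableSet_Ioi, smul_eq_mul, mul_comm] at h

lemma excess_eq_integral_tail (hβ : Integrable (fun b => b) β) (x : ℝ) :
    excess β x = ∫ t in Ioi 0, β.real (Ioi (x + t)) := by
  rw [excess, (integrable_excess hβ x).integral_eq_integral_meas_lt
    (ae_of_all _ fun b => le_max_right _ _)]
  refine setIntegral_congr_fun measurableSet_Ioi fun t (ht : 0 < t) => ?_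
  congr 1
  ext b
  simp only [mem_ofPred_eq, lt_max_iff, mem_Ioi, ht.not_gt, or_false, lt_sub_iff_add_lt']

/-- Karamata's theorem, in the weak form of two-sided bounds. -/
lemma IsRV.excess_mul (h : IsRV β r) (hβ : Integrable (fun b => b) β) {c : ℝ} (hc : 0 < c) :
    ∀ᶠ x in atTop, c ^ (1 + r) / 2 * excess β x ≤ excess β (c * x) ∧
      excess β (c * x) ≤ 2 * c ^ (1 + r) * excess β x := by
  have hcr := Real.rpow_pos_of_pos hc r
  have h1 : ∀ᶠ x in atTop, c ^ r / 2 * β.real (Ioi x) ≤ β.real (Ioi (c * x)) ∧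
      β.real (Ioi (c * x)) ≤ 2 * c ^ r * β.real (Ioi x) := by
    filter_upwards [(h.tendsto_ratio hc).eventually (Icc_mem_nhds
      (by linarith : c ^ r / 2 < c ^ r) (by linarith : c ^ r < 2 * c ^ r))] with x hx
    exact ⟨(le_div_iff₀ (h.tail_pos x)).1 hx.1, (div_le_iff₀ (h.tail_pos x)).1 hx.2⟩
  obtain ⟨x₀, hx₀⟩ := h1.exists_forall_of_atTop
  filter_upwards [eventually_ge_atTop x₀] with x hx
  have hi : ∀ y, IntegrableOn (fun t => β.real (Ioi (y + t))) (Ioi 0) := fun y => by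
    by_contra hn
    have := excess_pos hβ (h.tail_pos y)
    rw [excess_eq_integral_tail hβ, integral_undef hn] at this
    exact this.false
  have e : excess β (c * x) = c * ∫ t in Ioi 0, β.real (Ioi (c * (x + t))) := by
    have := integral_comp_mul_left_Ioi (fun t => β.real (Ioi (c * x + t))) 0 hc
    simp only [mul_zero, ← mul_add, smul_eq_mul] at this
    rw [this, excess_eq_integral_tail hβ, mul_inv_cancel_left₀ hc.ne']
  have hi' : IntegrableOn (fun t => β.real (Ioi (c * (x + t)))) (Ioi 0) := by
    have := (integrableOn_Ioi_comp_mul_left_iff (fun t => β.real (Ioi (c * x + t))) 0 hc).2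
      (by simpa using hi (c * x))
    simpa only [← mul_add] using this
  have hpt : ∀ t ∈ Ioi (0 : ℝ), c ^ r / 2 * β.real (Ioi (x + t)) ≤ β.real (Ioi (c * (x + t))) ∧
      β.real (Ioi (c * (x + t))) ≤ 2 * c ^ r * β.real (Ioi (x + t)) := fun t (ht : 0 < t) =>
    hx₀ (x + t) (by linarith)
  have hlo := setIntegral_mono_on ((hi x).const_mul (c ^ r / 2)) hi' measurableSet_Ioi
    fun t ht => (hpt t ht).1
  have hup := setIntegral_mono_on hi' ((hi x).const_mul (2 * c ^ r)) measurableSet_Ioi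
    fun t ht => (hpt t ht).2
  rw [integral_const_mul, ← excess_eq_integral_tail hβ] at hlo hup
  rw [e, Real.rpow_add hc, Real.rpow_one]
  constructor
  · linarith [mul_le_mul_of_nonneg_left hlo hc.le]
  · linarith [mul_le_mul_of_nonneg_left hup hc.le]

/-- A law whose tail is of the order of the integrated tail of a regularly varying law. -/
lemma isORV_of_tail_bounds (h : IsRV β r) (hβ : Integrable (fun b => b) β) {μ : Measure ℝ}
    [IsFiniteMeasure μ] {c C : ℝ} (hc : 0 < c)
    (hlo : ∀ᶠ x in atTop, c * excess β x ≤ μ.real (Ioi x))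
    (hup : ∀ᶠ x in atTop, μ.real (Ioi x) ≤ C * excess β x) : IsORV μ (1 + r) := by
  have hH : ∀ x, 0 < excess β x := fun x => excess_pos hβ (h.tail_pos x)
  have hC : 0 < C := by
    obtain ⟨x, h1, h2⟩ := (hlo.and hup).exists
    have := (mul_pos hc (hH x)).trans_le (h1.trans h2)
    exact pos_of_mul_pos_left this (hH x).le
  refine ⟨c / (4 * C), 4 * C / c, by positivity, by positivity, fun α hα => ?_⟩
  have hα0 : 0 < α := by linarith
  have hαr := Real.rpow_pos_of_pos hα0 (1 + r)
  have hmul : Tendsto (fun x : ℝ => α * x) atTop atTop := tendsto_id.const_mul_atTop hα0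
  have key : ∀ᶠ x in atTop, μ (Ioi (α * x)) / μ (Ioi x)
      ∈ Icc (ENNReal.ofReal (c / (2 * C) * α ^ (1 + r)))
        (ENNReal.ofReal (2 * C / c * α ^ (1 + r))) := by
    filter_upwards [hlo, hup, hmul.eventually hlo, hmul.eventually hup, h.excess_mul hβ hα0]
      with x h1 h2 h3 h4 ⟨h5, h6⟩
    have hx := hH x
    have hpos : 0 < μ.real (Ioi x) := (mul_pos hc hx).trans_le h1
    rw [← ofReal_measureReal (μ := μ) (s := Ioi (α * x)), ← ofReal_measureReal (μ := μ) (s := Ioi x),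
      ← ENNReal.ofReal_div_of_pos hpos]
    constructor <;> refine ENNReal.ofReal_le_ofReal ?_
    · rw [le_div_iff₀ hpos]
      calc c / (2 * C) * α ^ (1 + r) * μ.real (Ioi x)
          ≤ c / (2 * C) * α ^ (1 + r) * (C * excess β x) := by gcongr
        _ = c * (α ^ (1 + r) / 2 * excess β x) := by field_simp
        _ ≤ c * excess β (α * x) := by gcongr
        _ ≤ _ := h3
    · rw [div_le_iff₀ hpos]
      calc μ.real (Ioi (α * x)) ≤ C * excess β (α * x) := h4
        _ ≤ C * (2 * α ^ (1 + r) * excess β x) := by gcongr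
        _ = 2 * C / c * α ^ (1 + r) * (c * excess β x) := by field_simp
        _ ≤ _ := by gcongr
  constructor
  · refine lt_of_lt_of_le ?_ (le_liminf_of_le (by isBoundedDefault) (key.mono fun x hx => hx.1))
    rw [ENNReal.ofReal_lt_ofReal_iff (by positivity)]
    refine mul_lt_mul_of_pos_right ?_ hαr
    exact div_lt_div_of_pos_left hc (by positivity) (by linarith)
  · refine lt_of_le_of_lt (limsup_le_of_le (by isBoundedDefault) (key.mono fun x hx => hx.2)) ?_
    rw [ENNReal.ofReal_lt_ofReal_iff (by positivity)]
    refine mul_lt_mul_of_pos_right ?_ hαr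
    exact div_lt_div_of_pos_right (by linarith) hc

end regularVariation

section orderStatTail

/-- The tail of an order statistic of i.i.d. variables. -/
lemma pi_real_lt_orderStat {n k : ℕ} (h1 : 1 ≤ k) (h2 : k ≤ n) (μ : Measure ℝ)
    [IsProbabilityMeasure μ] (x : ℝ) :
    (Measure.pi fun _ : Fin n => μ).real {b | x < orderStat k b}
      = ∑ S : Finset (Fin n) with n < k + S.card,
        μ.real (Ioi x) ^ S.card * (1 - μ.real (Ioi x)) ^ (n - S.card) := by
  classical
  set E : Finset (Fin n) → Set (Fin n → ℝ) := fun S =>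
    univ.pi fun l => if l ∈ S then Ioi x else Iic x
  have hE : ∀ S b, b ∈ E S ↔ S = Finset.univ.filter fun l => x < b l := by
    intro S b
    simp only [E, Set.mem_pi, mem_univ, true_imp_iff, Finset.ext_iff, Finset.mem_filter,
      Finset.mem_univ, true_and]
    refine forall_congr' fun l => ?_
    by_cases hl : l ∈ S <;> simp [hl]
  have e : {b | x < orderStat k b}
      = ⋃ S ∈ Finset.univ.filter (fun S : Finset (Fin n) => n < k + S.card), E S := by
    ext b
    simp only [mem_ofPred_eq, mem_iUnion, Finset.mem_filter, Finset.mem_univ, true_and, hE,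
      lt_orderStat_iff h1 h2, Fintype.card_subtype]
    constructor
    · intro h; exact ⟨_, h, rfl⟩
    · rintro ⟨S, h, rfl⟩; exact h
  rw [e, measureReal_biUnion_finset]
  · refine Finset.sum_congr rfl fun S _ => ?_
    rw [measureReal_def, Measure.pi_pi, ENNReal.toReal_prod]
    have h3 : ∀ l, (μ (if l ∈ S then Ioi x else Iic x)).toReal
        = if l ∈ S then μ.real (Ioi x) else 1 - μ.real (Ioi x) := by
      intro l
      split_ifs
      · rfl
      · rw [← probReal_compl_eq_one_sub measurableSet_Ioi, compl_Ioi, measureReal_def]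
    simp only [h3]
    rw [Finset.prod_ite, Finset.prod_const, Finset.prod_const, Finset.filter_mem_eq_inter,
      Finset.univ_inter, Finset.filter_notMem_eq_sdiff, Finset.card_univ_sdiff, Fintype.card_fin]
  · intro S _ T _ hST
    refine disjoint_left.2 fun b hS hT => hST ?_
    rw [(hE S b).1 hS, (hE T b).1 hT]
  · intro S _
    refine MeasurableSet.univ_pi fun l => ?_
    split_ifs
    exacts [measurableSet_Ioi, measurableSet_Iic]

/-- Order statistics of i.i.d. regularly varying variables are regularly varying. -/
lemma isRV_orderStat_pi {n k : ℕ} (h1 : 1 ≤ k) (h2 : k ≤ n) {μ : Measure ℝ}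
    [IsProbabilityMeasure μ] {ν : ℝ} (h : IsRV μ (-ν)) :
    IsRV ((Measure.pi fun _ : Fin n => μ).map fun b => orderStat k b)
      (-(((n : ℝ) + 1 - k) * ν)) := by
  set m := n + 1 - k with hm
  set 𝒮 := Finset.univ.filter fun S : Finset (Fin n) => n < k + S.card
  set Ψ : ℝ → ℝ := fun p => ∑ S ∈ 𝒮, p ^ (S.card - m) * (1 - p) ^ (n - S.card) with hΨ
  have htail : ∀ x, ((Measure.pi fun _ : Fin n => μ).map fun b => orderStat k b).real (Ioi x)
      = μ.real (Ioi x) ^ m * Ψ (μ.real (Ioi x)) := by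
    intro x
    rw [map_measureReal_apply (measurable_orderStat k) measurableSet_Ioi]
    refine (pi_real_lt_orderStat h1 h2 μ x).trans ?_
    rw [hΨ, Finset.mul_sum]
    refine Finset.sum_congr rfl fun S hS => ?_
    have hS' : n < k + S.card := (Finset.mem_filter.1 hS).2
    rw [← mul_assoc, ← pow_add, Nat.add_sub_cancel' (by omega)]
  have hΨ0 : 0 < Ψ 0 := by
    obtain ⟨S, -, hS⟩ := Finset.exists_subset_card_eq
      (s := (Finset.univ : Finset (Fin n))) (n := m) (by simp; omega)
    refine Finset.sum_pos' (fun S _ => by positivity) ⟨S, ?_, ?_⟩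
    · simp only [𝒮, Finset.mem_filter, Finset.mem_univ, true_and]; omega
    · simp [hS]
  have hΨc : Continuous Ψ := by rw [hΨ]; fun_prop
  have hp : Tendsto (fun x => μ.real (Ioi x)) atTop (nhds 0) := tendsto_tail (P := μ) measurable_id
  refine isRV_of_tendsto_ratio fun c hc => ?_
  have hpc : Tendsto (fun x => μ.real (Ioi (c * x))) atTop (nhds 0) :=
    hp.comp (tendsto_id.const_mul_atTop hc)
  have hq := ((hΨc.tendsto 0).comp hpc).div ((hΨc.tendsto 0).comp hp) hΨ0.ne'
  have hl := ((h.tendsto_ratio hc).pow m).mul hq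
  rw [div_self hΨ0.ne', mul_one, ← Real.rpow_natCast, ← Real.rpow_mul hc.le] at hl
  have hmr : (m : ℝ) = (n : ℝ) + 1 - k := by
    rw [hm, Nat.cast_sub (by omega)]; push_cast; ring
  have he : -ν * (m : ℝ) = -(((n : ℝ) + 1 - k) * ν) := by rw [hmr]; ring
  rw [he] at hl
  refine hl.congr fun x => ?_
  rw [htail, htail, div_pow, mul_div_mul_comm]
  rfl

end orderStatTail

section steadyState

variable {N nF nJ : ℕ} {lawA : Measure ℝ} {lawB : Measure (Fin nF → ℝ)} {π : Measure (Fin N → ℝ)}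

lemma IsSteadyState.ae_nonneg (hπ : IsSteadyState nJ lawA lawB π) : ∀ᵐ v ∂π, ∀ i, 0 ≤ v i := by
  rw [← hπ.2]
  refine (ae_map_iff measurable_nextWorkload.aemeasurable ?_).2
    (ae_of_all _ fun p i => nextWorkload_nonneg _ _ _ _ i)
  have : {v : Fin N → ℝ | ∀ i, 0 ≤ v i} = Ici 0 := by ext; simp [Pi.le_def]
  rw [this]
  exact measurableSet_Ici

lemma IsSteadyState.measurePreserving (hπ : IsSteadyState nJ lawA lawB π) :
    MeasurePreserving (fun p => nextWorkload nJ p.1 p.2.1 p.2.2.1 p.2.2.2)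
      (π.prod (jobLaw N lawA lawB)) π :=
  ⟨measurable_nextWorkload, hπ.2⟩

lemma integrable_orderStat_map (hB : Integrable (fun b => orderStat nJ b) lawB) :
    Integrable (fun b => b) (lawB.map fun b => orderStat nJ b) :=
  (integrable_map_measure measurable_id.aestronglyMeasurable
    (measurable_orderStat nJ).aemeasurable).2 hB

lemma excess_orderStat_eq (x : ℝ) : excess (lawB.map fun b => orderStat nJ b) x
    = ∫ b, max (orderStat nJ b - x) 0 ∂lawB := by
  rw [excess, integral_map (measurable_orderStat nJ).aemeasurable]
  exact Measurable.aestronglyMeasurable (by fun_prop)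

variable [IsProbabilityMeasure lawA] [IsProbabilityMeasure lawB]

lemma IsSteadyState.integral_comp_nextWorkload (hFN : nF ≤ N) (hπ : IsSteadyState nJ lawA lawB π)
    {g : (Fin N → ℝ) → ℝ} (hg : Measurable g) :
    ∫ p, g (nextWorkload nJ p.1 p.2.1 p.2.2.1 p.2.2.2) ∂π.prod (jobLaw N lawA lawB)
      = ∫ p, g p.1 ∂π.prod (jobLaw N lawA lawB) := by
  have := hπ.1
  have := isProbabilityMeasure_jobLaw lawA lawB hFN
  rw [MeasurePreserving.integral_comp_of_measurable hπ.measurePreserving hg,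
    MeasurePreserving.integral_comp_of_measurable measurePreserving_fst hg]

/-- In steady state, the tail of the largest workload is at most of the order of the integrated tail
of `B_(nJ)`. -/
lemma IsSteadyState.exists_maxLoad_tail_le (hJ : 1 ≤ nJ) (hJF : nJ ≤ nF) (hFN : nF ≤ N)
    (hA : Integrable (fun a => a) lawA) (hA0 : ∀ᵐ a ∂lawA, 0 ≤ a)
    (hB : Integrable (fun b => orderStat nJ b) lawB) (hB0 : ∀ᵐ b ∂lawB, ∀ l, 0 ≤ b l)
    (hstab : (∫ b, orderStat nJ b ∂lawB) < ∫ a, a ∂lawA) (hπ : IsSteadyState nJ lawA lawB π)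
    {r : ℝ} (hRV : IsRV (lawB.map fun b => orderStat nJ b) r) :
    ∃ C, 0 < C ∧ ∀ᶠ x in atTop, π.real {v | x < maxLoad v}
      ≤ C * excess (lawB.map fun b => orderStat nJ b) x := by
  have := hπ.1
  have hκ := isProbabilityMeasure_jobLaw lawA lawB hFN
  have hβ : IsProbabilityMeasure (lawB.map fun b => orderStat nJ b) :=
    Measure.isProbabilityMeasure_map (measurable_orderStat nJ).aemeasurable
  have hβi := integrable_orderStat_map hB
  set β := lawB.map fun b => orderStat nJ b
  set κ := jobLaw N lawA lawB with hκdef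
  set δ := (∫ a, a ∂lawA) - ∫ b, orderStat nJ b ∂lawB with hδ
  have hδ0 : 0 < δ := sub_pos.2 hstab
  have hX := integrable_increment (N := N) hFN hA hB
  set ψ : ℝ → ℝ := fun a =>
    ∫ j, |orderStat nJ j.2.1 - j.2.2| * min 1 (|orderStat nJ j.2.1 - j.2.2| / a) ∂κ
  have hord : StochLE (π.prod κ) (fun p => maxLoad p.1)
      (fun p => maxLoad (nextWorkload nJ p.1 p.2.1 p.2.2.1 p.2.2.2)) := fun g hgc _ _ =>
    (hπ.integral_comp_nextWorkload hFN (hgc.measurable.comp measurable_maxLoad)).ge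
  have hexc : ∀ y, ∫ j, max (orderStat nJ j.2.1 - j.2.2 - y) 0 ∂κ ≤ excess β y := by
    intro y
    rw [excess_orderStat_eq, ← MeasurePreserving.integral_comp_of_measurable
      (measurePreserving_sizes (N := N) lawA lawB hFN)
      (g := fun b => max (orderStat nJ b - y) 0)
      (((measurable_orderStat nJ).sub_const y).max measurable_const)]
    refine integral_mono_ae (hX.sub (integrable_const y)).pos_part
      ((measurePreserving_sizes lawA lawB hFN).integrable_comp_of_integrable
        (hB.sub (integrable_const y)).pos_part) ?_
    filter_upwards [ae_time_nonneg (lawB := lawB) hFN hA0] with j hj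
    exact max_le_max (by linarith) le_rfl
  obtain ⟨D, hD, hDH⟩ : ∃ D, 0 < D ∧ ∀ᶠ x in atTop, excess β (x / 4) ≤ D * excess β x := by
    have h4 : (0 : ℝ) < 4 ^ (1 + r) := Real.rpow_pos_of_pos (by norm_num) _
    refine ⟨2 / 4 ^ (1 + r), by positivity, ?_⟩
    filter_upwards [(tendsto_id.atTop_div_const (by norm_num : (0 : ℝ) < 4)).eventually
      (hRV.excess_mul hβi (by norm_num : (0 : ℝ) < 4))] with x hx
    have h1 := hx.1
    rw [id, mul_div_cancel₀ x (by norm_num)] at h1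
    rw [div_mul_eq_mul_div, le_div_iff₀ h4]
    linarith
  refine tail_le_of_recursion (e := fun x => |ψ (x / 2)| / δ) (D := max D (1 / δ))
    (fun x => measureReal_le_one) (fun x => excess_pos hβi (hRV.tail_pos x)) (excess_antitone hβi)
    (fun x => by positivity) ?_ (lt_max_of_lt_left hD) ?_ ?_
  · have h1 := ((tendsto_integral_mul_min hX).comp
      (tendsto_id.atTop_div_const two_pos)).abs.div_const δ
    simpa using h1
  · exact hDH.mono fun x hx => hx.trans (mul_le_mul_of_nonneg_right (le_max_left _ _)
      (excess_pos hβi (hRV.tail_pos x)).le)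
  · filter_upwards [eventually_gt_atTop 0] with x hx
    have h := maxLoad_tail_le hJ hJF hFN hA hB hB0 (P := π) (V := fun v => v) measurable_id hord
      (half_pos hx)
    rw [show 2 * (x / 2) = x by ring, show x / 2 / 2 = x / 4 by ring] at h
    have h1 := hexc (x / 4)
    have h2 : ψ (x / 2) * π.real {v | x / 4 < maxLoad v}
        ≤ |ψ (x / 2)| * π.real {v | x / 4 < maxLoad v} :=
      mul_le_mul_of_nonneg_right (le_abs_self _) measureReal_nonneg
    have h3 : 1 / δ * excess β (x / 4) ≤ max D (1 / δ) * excess β (x / 4) :=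
      mul_le_mul_of_nonneg_right (le_max_right _ _) (excess_pos hβi (hRV.tail_pos _)).le
    have h4 : π.real {v | x < maxLoad v} ≤ 1 / δ * excess β (x / 4)
        + |ψ (x / 2)| / δ * π.real {v | x / 4 < maxLoad v} := by
      rw [one_div_mul_eq_div, div_mul_eq_mul_div, ← add_div, le_div_iff₀ hδ0, mul_comm]
      exact h.trans (add_le_add h1 h2)
    linarith

/-- In steady state, the tail of the `(nF - nJ + 1)`-th largest workload is at least of the order of
the integrated tail of `B_(nJ)`. -/
lemma IsSteadyState.exists_le_topLoad_tail (hJ : 1 ≤ nJ) (hJF : nJ ≤ nF) (hFN : nF ≤ N)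
    (hA : Integrable (fun a => a) lawA) (hA0 : ∀ᵐ a ∂lawA, 0 ≤ a) (hA1 : 0 < ∫ a, a ∂lawA)
    (hB : Integrable (fun b => orderStat nJ b) lawB) (hB0 : ∀ᵐ b ∂lawB, ∀ l, 0 ≤ b l)
    (hπ : IsSteadyState nJ lawA lawB π)
    {r : ℝ} (hRV : IsRV (lawB.map fun b => orderStat nJ b) r) :
    ∃ c, 0 < c ∧ ∀ᶠ x in atTop, c * excess (lawB.map fun b => orderStat nJ b) x
      ≤ π.real {v | x < topLoad nF nJ v} := by
  have := hπ.1
  have hκ := isProbabilityMeasure_jobLaw lawA lawB hFN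
  have hβ : IsProbabilityMeasure (lawB.map fun b => orderStat nJ b) :=
    Measure.isProbabilityMeasure_map (measurable_orderStat nJ).aemeasurable
  have hβi := integrable_orderStat_map hB
  set β := lawB.map fun b => orderStat nJ b
  set κ := jobLaw N lawA lawB with hκdef
  have h1 : MeasurePreserving Prod.fst (π.prod κ) π := measurePreserving_fst
  have h2 : MeasurePreserving Prod.snd (π.prod κ) κ := measurePreserving_snd
  have hsz := measurePreserving_sizes (N := N) lawA lawB hFN
  have htm := measurePreserving_time (N := N) lawA lawB hFN
  have hT : Measurable (topLoad nF nJ : (Fin N → ℝ) → ℝ) := measurable_topLoad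
  have hBm : Measurable fun j : (Fin nF → Fin N) × (Fin nF → ℝ) × ℝ => orderStat nJ j.2.1 :=
    (measurable_orderStat nJ).comp (measurable_fst.comp measurable_snd)
  have hAm : Measurable fun j : (Fin nF → Fin N) × (Fin nF → ℝ) × ℝ => j.2.2 :=
    measurable_snd.comp measurable_snd
  -- the drift inequality
  have hdrift : ∀ x, π.real {v | topLoad nF nJ v ≤ x}
      * ∫ j, max (orderStat nJ j.2.1 - j.2.2 - x) 0 ∂κ
      ≤ (∫ a, a ∂lawA) * π.real {v | x < topLoad nF nJ v} := by
    intro x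
    have key := drift_tail_ge (P := π.prod κ) (T := fun p => topLoad nF nJ p.1)
      (T' := fun p => topLoad nF nJ (nextWorkload nJ p.1 p.2.1 p.2.2.1 p.2.2.2))
      (A := fun p => p.2.2.2) (B := fun p => orderStat nJ p.2.2.1)
      (hT.comp measurable_fst) (hT.comp measurable_nextWorkload)
      (h2.integrable_comp_of_integrable (htm.integrable_comp_of_integrable hA))
      (h2.integrable_comp_of_integrable (hsz.integrable_comp_of_integrable hB))
      (hAm.comp measurable_snd) (hBm.comp measurable_snd)
      (h2.quasiMeasurePreserving.ae (ae_time_nonneg hFN hA0))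
      (ProbabilityTheory.indepFun_prod hT (hAm.prodMk hBm))
      (by
        filter_upwards [h1.quasiMeasurePreserving.ae hπ.ae_nonneg,
          h2.quasiMeasurePreserving.ae (ae_sizes_nonneg hFN hB0),
          h2.quasiMeasurePreserving.ae (ae_injective_servers lawA lawB hFN)] with p hv hb hs
        exact le_topLoad_nextWorkload hJ hJF hFN hv hs hb _)
      (fun g hgc _ _ => (hπ.integral_comp_nextWorkload hFN (hgc.measurable.comp hT)).le) x
    rw [MeasurePreserving.integral_comp_of_measurable h2
        (g := fun j => max (orderStat nJ j.2.1 - j.2.2 - x) 0)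
        (((hBm.sub hAm).sub_const x).max measurable_const),
      MeasurePreserving.integral_comp_of_measurable h2 hAm,
      MeasurePreserving.integral_comp_of_measurable htm measurable_id'] at key
    have e1 : (π.prod κ).real {p | topLoad nF nJ p.1 ≤ x} = π.real {v | topLoad nF nJ v ≤ x} :=
      h1.measureReal_preimage (measurableSet_le hT measurable_const).nullMeasurableSet
    have e2 : (π.prod κ).real {p | x < topLoad nF nJ p.1} = π.real {v | x < topLoad nF nJ v} :=
      h1.measureReal_preimage (measurableSet_lt measurable_const hT).nullMeasurableSet
    rwa [e1, e2] at key
  -- short interarrival times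
  obtain ⟨K, hK⟩ : ∃ K : ℝ, 1 / 2 < lawA.real (Iic K) := by
    have h := (tendsto_tail (P := lawA) measurable_id).eventually
      (gt_mem_nhds (by norm_num : (0 : ℝ) < 1 / 2))
    obtain ⟨K, hK⟩ := h.exists
    refine ⟨K, ?_⟩
    have := probReal_compl_eq_one_sub (μ := lawA) (s := Ioi K) measurableSet_Ioi
    rw [compl_Ioi] at this
    rw [this]
    have hK' : lawA.real (Ioi K) < 1 / 2 := hK
    linarith
  have hjob : ∀ x, 1 / 2 * excess β (x + K)
      ≤ ∫ j, max (orderStat nJ j.2.1 - j.2.2 - x) 0 ∂κ := by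
    intro x
    have hst := measurePreserving_sizes_time (N := N) lawA lawB hFN
    have hi1 : Integrable (fun b => max (orderStat nJ b - (x + K)) 0) lawB :=
      (hB.sub (integrable_const _)).pos_part
    have hi2 : Integrable ((Iic K).indicator (1 : ℝ → ℝ)) lawA :=
      (integrable_const 1).indicator measurableSet_Iic
    have e := integral_prod_mul (μ := lawB) (ν := lawA)
      (fun b => max (orderStat nJ b - (x + K)) 0) ((Iic K).indicator (1 : ℝ → ℝ))
    rw [integral_indicator_one measurableSet_Iic, ← excess_orderStat_eq] at e
    have hle : ∫ z : (Fin nF → ℝ) × ℝ, max (orderStat nJ z.1 - (x + K)) 0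
        * (Iic K).indicator (1 : ℝ → ℝ) z.2 ∂lawB.prod lawA
        ≤ ∫ z : (Fin nF → ℝ) × ℝ, max (orderStat nJ z.1 - z.2 - x) 0 ∂lawB.prod lawA := by
      refine integral_mono (hi1.mul_prod hi2) ?_ fun z => ?_
      · exact (((measurePreserving_fst (ν := lawA)).integrable_comp_of_integrable hB).sub
          ((measurePreserving_snd (μ := lawB)).integrable_comp_of_integrable hA)).sub
          (integrable_const x) |>.pos_part
      · by_cases hz : z.2 ∈ Iic K
        · simp only [indicator_of_mem hz, Pi.one_apply, mul_one]
          have hz' : z.2 ≤ K := hz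
          exact max_le_max (by linarith) le_rfl
        · simp only [indicator_of_notMem hz, mul_zero]
          exact le_max_right _ _
    rw [e, ← MeasurePreserving.integral_comp_of_measurable hst
      (g := fun z => max (orderStat nJ z.1 - z.2 - x) 0)
      (((((measurable_orderStat nJ).comp measurable_fst).sub measurable_snd).sub_const x).max
        measurable_const)] at hle
    have hH := (excess_pos hβi (hRV.tail_pos (x + K))).le
    have := mul_le_mul_of_nonneg_left hK.le hH
    linarith
  have h2r : (0 : ℝ) < 2 ^ (1 + r) := Real.rpow_pos_of_pos two_pos _
  refine ⟨2 ^ (1 + r) / 8 / ∫ a, a ∂lawA, by positivity, ?_⟩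
  filter_upwards [eventually_ge_atTop K, hRV.excess_mul hβi two_pos,
    (tendsto_tail (P := π) hT).eventually (gt_mem_nhds (by norm_num : (0 : ℝ) < 1 / 2))]
    with x hx hx2 hx3
  have hP : 1 / 2 ≤ π.real {v | topLoad nF nJ v ≤ x} := by
    have h := probReal_compl_eq_one_sub (μ := π) (measurableSet_lt measurable_const hT :
      MeasurableSet {v | x < topLoad nF nJ v})
    have hc : {v : Fin N → ℝ | x < topLoad nF nJ v}ᶜ = {v | topLoad nF nJ v ≤ x} := by
      ext v; simp
    rw [hc] at h
    rw [h]
    linarith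
  have h3 : excess β (2 * x) ≤ excess β (x + K) := excess_antitone hβi (by linarith)
  have h4 := hjob x
  have h5 := hdrift x
  have h6 : 1 / 2 * ∫ j, max (orderStat nJ j.2.1 - j.2.2 - x) 0 ∂κ
      ≤ (∫ a, a ∂lawA) * π.real {v | x < topLoad nF nJ v} :=
    (mul_le_mul_of_nonneg_right hP (integral_nonneg fun _ => le_max_right _ _)).trans h5
  rw [div_mul_eq_mul_div, div_le_iff₀ hA1]
  linarith [hx2.1]

/-- The selection of the servers makes the waiting time as large as `topLoad` with a probability
that is bounded away from zero. -/
lemma exists_topLoad_tail_le_waitingTime_tail (hJ : 1 ≤ nJ) (hJF : nJ ≤ nF) (hFN : nF ≤ N)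
    [IsProbabilityMeasure π] :
    ∃ p : ℝ, 0 < p ∧ ∀ x, p * π.real {v | x < topLoad nF nJ v}
      ≤ (π.prod (jobLaw N lawA lawB)).real {q | x < waitingTime nJ q.1 q.2.1} := by
  have hκ := isProbabilityMeasure_jobLaw lawA lawB hFN
  have hσ := isProbabilityMeasure_serverLaw hFN
  set S : Set (Fin nF → Fin N) := {s | Function.Injective s}
  have hS : (Measure.count S)⁻¹ ≠ 0 := by
    rw [ENNReal.inv_ne_zero]
    exact (Measure.count_apply_lt_top.2 (toFinite S)).ne
  have hle : ∀ x, (Measure.count S)⁻¹ * π {v | x < topLoad nF nJ v}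
      ≤ (π.prod (jobLaw N lawA lawB)) {q | x < waitingTime nJ q.1 q.2.1} := by
    intro x
    have hm : MeasurableSet {q : (Fin N → ℝ) × (Fin nF → Fin N) × (Fin nF → ℝ) × ℝ |
        x < waitingTime nJ q.1 q.2.1} := measurableSet_lt measurable_const measurable_waitingTime
    rw [Measure.prod_apply hm, ← lintegral_indicator_const
      (measurableSet_lt measurable_const measurable_topLoad)]
    refine lintegral_mono fun v => ?_
    refine indicator_le' (f := fun _ => (Measure.count S)⁻¹)
      (g := fun v => jobLaw N lawA lawB (Prod.mk v ⁻¹' {q | x < waitingTime nJ q.1 q.2.1}))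
      (fun v (hv : x < topLoad nF nJ v) => ?_) (fun _ _ => zero_le) v
    obtain ⟨s, hs, hsv⟩ := exists_waitingTime_eq_topLoad hJ hJF hFN v
    have hsub : ({s} : Set (Fin nF → Fin N)) ×ˢ (univ : Set ((Fin nF → ℝ) × ℝ))
        ⊆ Prod.mk v ⁻¹' {q | x < waitingTime nJ q.1 q.2.1} := by
      rintro ⟨s', z⟩ ⟨hs', -⟩
      obtain rfl : s' = s := hs'
      exact hv.trans_eq hsv.symm
    refine le_trans (le_of_eq ?_) (measure_mono hsub)
    rw [jobLaw, Measure.prod_prod, measure_univ, mul_one, ProbabilityTheory.uniformOn,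
      ProbabilityTheory.cond_apply (toFinite S).measurableSet,
      inter_eq_self_of_subset_right (singleton_subset_iff.2 hs), Measure.count_singleton, mul_one]
  have hfin : (Measure.count S)⁻¹ ≠ ⊤ := by
    rw [ENNReal.inv_ne_top, Measure.count_ne_zero_iff]
    exact ⟨Fin.castLE hFN, Fin.castLE_injective hFN⟩
  refine ⟨((Measure.count S)⁻¹).toReal, ENNReal.toReal_pos hS hfin, fun x => ?_⟩
  rw [measureReal_def, measureReal_def, ← ENNReal.toReal_mul]
  exact ENNReal.toReal_mono (measure_ne_top _ _) (hle x)

theorem IsSteadyState.isORV (hJ : 1 ≤ nJ) (hJF : nJ ≤ nF) (hFN : nF ≤ N)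
    (hA : Integrable (fun a => a) lawA) (hA0 : ∀ᵐ a ∂lawA, 0 ≤ a)
    (hB : Integrable (fun b => orderStat nJ b) lawB) (hB0 : ∀ᵐ b ∂lawB, ∀ l, 0 ≤ b l)
    (hA1 : 0 < ∫ a, a ∂lawA)
    (hstab : (∫ b, orderStat nJ b ∂lawB) < ∫ a, a ∂lawA) (hπ : IsSteadyState nJ lawA lawB π)
    {ν : ℝ} (hRV : IsRV (lawB.map fun b => orderStat nJ b) (-ν)) :
    IsORV (waitingLaw nJ lawA lawB π) (1 - ν) ∧ IsORV (responseLaw nJ lawA lawB π) (1 - ν) := by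
  obtain ⟨C, hC, hup⟩ := hπ.exists_maxLoad_tail_le hJ hJF hFN hA hA0 hB hB0 hstab hRV
  obtain ⟨c, hc, hlo⟩ := hπ.exists_le_topLoad_tail hJ hJF hFN hA hA0 hA1 hB hB0 hRV
  have := hπ.1
  obtain ⟨p, hp, hsel⟩ := exists_topLoad_tail_le_waitingTime_tail (lawA := lawA) (lawB := lawB)
    (π := π) hJ hJF hFN
  have hκ := isProbabilityMeasure_jobLaw lawA lawB hFN
  have hβ : IsProbabilityMeasure (lawB.map fun b => orderStat nJ b) :=
    Measure.isProbabilityMeasure_map (measurable_orderStat nJ).aemeasurable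
  have hβi := integrable_orderStat_map hB
  have hβt : ∀ x, (lawB.map fun b => orderStat nJ b).real (Ioi x)
      = lawB.real {b | x < orderStat nJ b} := fun x =>
    map_measureReal_apply (measurable_orderStat nJ) measurableSet_Ioi
  set β := lawB.map fun b => orderStat nJ b
  set κ := jobLaw N lawA lawB
  have h1 : MeasurePreserving Prod.fst (π.prod κ) π := measurePreserving_fst
  have h2 : MeasurePreserving (fun q : (Fin N → ℝ) × (Fin nF → Fin N) × (Fin nF → ℝ) × ℝ =>
      q.2.2.1) (π.prod κ) lawB := (measurePreserving_sizes lawA lawB hFN).comp measurePreserving_snd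
  have hb : ∀ᵐ q ∂π.prod κ, ∀ l, 0 ≤ q.2.2.1 l := h2.quasiMeasurePreserving.ae hB0
  have hWt : ∀ x, (waitingLaw nJ lawA lawB π).real (Ioi x)
      = (π.prod κ).real {q | x < waitingTime nJ q.1 q.2.1} := fun x =>
    map_measureReal_apply measurable_waitingTime measurableSet_Ioi
  have hRt : ∀ x, (responseLaw nJ lawA lawB π).real (Ioi x)
      = (π.prod κ).real {q | x < responseTime nJ q.1 q.2.1 q.2.2.1} := fun x =>
    map_measureReal_apply measurable_responseTime measurableSet_Ioi
  have hWp : IsProbabilityMeasure (waitingLaw nJ lawA lawB π) :=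
    Measure.isProbabilityMeasure_map measurable_waitingTime.aemeasurable
  have hRp : IsProbabilityMeasure (responseLaw nJ lawA lawB π) :=
    Measure.isProbabilityMeasure_map measurable_responseTime.aemeasurable
  have hWR : ∀ x, (waitingLaw nJ lawA lawB π).real (Ioi x)
      ≤ (responseLaw nJ lawA lawB π).real (Ioi x) := fun x => by
    rw [hWt, hRt]
    refine ENNReal.toReal_mono (measure_ne_top _ _) (measure_mono_ae ?_)
    exact hb.mono fun q hq (h : x < _) => h.trans_le (waitingTime_le_responseTime _ _ hq)
  have hWlo : ∀ᶠ x in atTop, p * c * excess β x ≤ (waitingLaw nJ lawA lawB π).real (Ioi x) := by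
    filter_upwards [hlo] with x hx
    rw [hWt, mul_assoc]
    exact (mul_le_mul_of_nonneg_left hx hp.le).trans (hsel x)
  obtain ⟨D, hD⟩ : ∃ D, ∀ᶠ x in atTop,
      (responseLaw nJ lawA lawB π).real (Ioi x) ≤ D * excess β x := by
    have h4 : (0 : ℝ) < (1 / 4) ^ (1 + -ν) := Real.rpow_pos_of_pos (by norm_num) _
    have h2' : (0 : ℝ) < (1 / 2) ^ (1 + -ν) := Real.rpow_pos_of_pos (by norm_num) _
    refine ⟨C * (2 * (1 / 2) ^ (1 + -ν)) + 2 * (1 / 4) ^ (1 + -ν), ?_⟩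
    filter_upwards [(tendsto_id.const_mul_atTop (by norm_num : (0 : ℝ) < 1 / 2)).eventually hup,
      hRV.excess_mul hβi (by norm_num : (0 : ℝ) < 1 / 2),
      hRV.excess_mul hβi (by norm_num : (0 : ℝ) < 1 / 4), eventually_ge_atTop 4]
      with x hx1 hx2 hx3 hx4
    have hsub : {q : (Fin N → ℝ) × (Fin nF → Fin N) × (Fin nF → ℝ) × ℝ |
        x < responseTime nJ q.1 q.2.1 q.2.2.1} ⊆ {q | 1 / 2 * x < maxLoad q.1}
        ∪ {q | 1 / 2 * x < orderStat nJ q.2.2.1} := by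
      intro q (hq : x < _)
      by_contra hn
      simp only [mem_union, mem_ofPred_eq, not_or, not_lt] at hn
      have := responseTime_le hJ hJF q.1 q.2.1 q.2.2.1
      linarith [hn.1, hn.2]
    have e1 : (π.prod κ).real {q | 1 / 2 * x < maxLoad q.1} = π.real {v | 1 / 2 * x < maxLoad v} :=
      h1.measureReal_preimage
        (measurableSet_lt measurable_const measurable_maxLoad).nullMeasurableSet
    have e2 : (π.prod κ).real {q | 1 / 2 * x < orderStat nJ q.2.2.1} = β.real (Ioi (1 / 2 * x)) := by
      rw [hβt]
      exact h2.measureReal_preimage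
        (measurableSet_lt measurable_const (measurable_orderStat nJ)).nullMeasurableSet
    have h5 := (measureReal_mono (μ := π.prod κ) hsub).trans (measureReal_union_le _ _)
    rw [e1, e2, ← hRt] at h5
    have h6 := tail_mul_le_excess hβi (1 / 4 * x) (1 / 2 * x)
    have h7 : β.real (Ioi (1 / 2 * x)) ≤ (1 / 2 * x - 1 / 4 * x) * β.real (Ioi (1 / 2 * x)) :=
      le_mul_of_one_le_left measureReal_nonneg (by linarith)
    have h8 := mul_le_mul_of_nonneg_left hx2.2 hC.le
    simp only [id] at hx1
    linarith [hx3.2]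
  have hr : 1 - ν = 1 + -ν := sub_eq_add_neg _ _
  rw [hr]
  exact ⟨isORV_of_tail_bounds hRV hβi (mul_pos hp hc) hWlo (hD.mono fun x hx => (hWR x).trans hx),
    isORV_of_tail_bounds hRV hβi (mul_pos hp hc) (hWlo.mono fun x hx => hx.trans (hWR x)) hD⟩

end steadyState

end ForkJoin

theorem corollary3 (N nF nJ : ℕ) (hJ : 1 ≤ nJ) (hJF : nJ ≤ nF) (hFN : nF ≤ N)
    -- interarrival times
    (lawA : Measure ℝ) [IsProbabilityMeasure lawA] (hA_nonneg : ∀ᵐ a ∂lawA, 0 ≤ a)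
    (hA_int : Integrable (fun a => a) lawA) (hA_pos : 0 < ∫ a, a ∂lawA)
    -- joint law of the replica sizes of a job, with common marginal law
    (lawB : Measure (Fin nF → ℝ)) [IsProbabilityMeasure lawB]
    (margB : Measure ℝ) (hB_marg : ∀ l, lawB.map (fun b => b l) = margB)
    (hB_nonneg : ∀ᵐ x ∂margB, 0 ≤ x)
    -- finite mean of the order statistic, and load less than one
    (hB_int : Integrable (fun b => ForkJoin.orderStat nJ b) lawB)
    (hρ : ForkJoin.rhoU nJ lawA lawB < 1) :
    (∃ π : Measure (Fin N → ℝ), ForkJoin.IsSteadyState nJ lawA lawB π) ∧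
    ∀ π : Measure (Fin N → ℝ), ForkJoin.IsSteadyState nJ lawA lawB π →
      (∀ ν' : ℝ, ForkJoin.IsRV (lawB.map (fun b => ForkJoin.orderStat nJ b)) (-ν') →
        ForkJoin.IsORV (ForkJoin.waitingLaw nJ lawA lawB π) (1 - ν') ∧
        ForkJoin.IsORV (ForkJoin.responseLaw nJ lawA lawB π) (1 - ν')) ∧
      -- identical replicas
      ((∀ᵐ b ∂lawB, ∀ l m, b l = b m) → ∀ ν : ℝ, ForkJoin.IsRV margB (-ν) →
        ForkJoin.IsORV (ForkJoin.waitingLaw nJ lawA lawB π) (1 - ν) ∧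
        ForkJoin.IsORV (ForkJoin.responseLaw nJ lawA lawB π) (1 - ν)) ∧
      -- i.i.d. replicas
      (lawB = Measure.pi (fun _ => margB) → ∀ ν : ℝ, ForkJoin.IsRV margB (-ν) →
        ForkJoin.IsORV (ForkJoin.waitingLaw nJ lawA lawB π)
          (1 - ((nF : ℝ) + 1 - (nJ : ℝ)) * ν) ∧
        ForkJoin.IsORV (ForkJoin.responseLaw nJ lawA lawB π)
          (1 - ((nF : ℝ) + 1 - (nJ : ℝ)) * ν)) := by
  have hB0 : ∀ᵐ b ∂lawB, ∀ l, 0 ≤ b l := by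
    refine ae_all_iff.2 fun l => ?_
    rw [← hB_marg l] at hB_nonneg
    exact ae_of_ae_map (measurable_pi_apply l).aemeasurable hB_nonneg
  have hstab : (∫ b, ForkJoin.orderStat nJ b ∂lawB) < ∫ a, a ∂lawA := by
    rwa [ForkJoin.rhoU, div_lt_one hA_pos] at hρ
  have l₀ : Fin nF := ⟨0, by omega⟩
  refine ⟨ForkJoin.exists_isSteadyState hJ hJF hFN hA_int hB_int hB0 hstab, fun π hπ => ?_⟩
  have key : ∀ ν' : ℝ, ForkJoin.IsRV (lawB.map (fun b => ForkJoin.orderStat nJ b)) (-ν') →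
      ForkJoin.IsORV (ForkJoin.waitingLaw nJ lawA lawB π) (1 - ν') ∧
      ForkJoin.IsORV (ForkJoin.responseLaw nJ lawA lawB π) (1 - ν') := fun ν' hν' =>
    hπ.isORV hJ hJF hFN hA_int hA_nonneg hB_int hB0 hA_pos hstab hν'
  refine ⟨key, fun hid ν hν => key ν ?_, fun hiid ν hν => key _ ?_⟩
  · have : (lawB.map fun b => ForkJoin.orderStat nJ b) = margB := by
      rw [← hB_marg l₀]
      refine Measure.map_congr (hid.mono fun b hb => ?_)
      obtain ⟨l, hl⟩ := ForkJoin.orderStat_mem hJ hJF b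
      exact hl.trans (hb l l₀)
    rwa [this]
  · have : IsProbabilityMeasure margB := by
      rw [← hB_marg l₀]
      exact Measure.isProbabilityMeasure_map (measurable_pi_apply l₀).aemeasurable
    rw [hiid]
    exact ForkJoin.isRV_orderStat_pi hJ hJF hν
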